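/- Fix $\lambda>0$, $\tau_0>0$, $q>1/2$, $\beta\ge q$ and $L_0>0$. Consider the Gaussian white noise model on $[0,1]$ with noise level $1/\sqrt n$, written in the coordinates of an orthonormal basis $(\psi_j)_{j\ge1}$ of $L^2(0,1)$: one observes $X=(X_j)_{j\ge1}$ with $$X_j=\theta_{0j}+\tfrac1{\sqrt n}\,\xi_j,\qquad \xi_1,\xi_2,\dots\ \text{i.i.d. } N(0,1),$$ where $\boldsymbol f_0=\sum_j\theta_{0j}\psi_j$ and $\theta_0$ lies in the Sobolev class $\Theta_\beta(L_0)=\{\theta:\sum_{j\ge1}\theta_j^2j^{2\beta}<L_0\}$; let $\mathbb E_0^{(n)}$ be the expectation under this law. Let $\Pi$ be the conditional Gaussian sieve prior: $k\sim\mathrm{Poisson}(\lambda)$ (either on $\{0,1,2,\dots\}$, with $k=0$ giving $\theta=0$, or conditioned on $k\ge1$) and, given $k$, the coordinates are independent with $\theta_j\sim N(0,\tau_0j^{-2q})$ for $j\le k$ and $\theta_j=0$ for $j>k$. Let $\hat\theta_n$ be the posterior mean, i.e. $\hat\theta_{nj}=\int\theta_j\,d\Pi(\theta\mid X)$, where $d\Pi(\theta\mid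 X)\propto\exp\bigl(n\sum_j\theta_jX_j-\tfrac n2\sum_j\theta_j^2\bigr)\,d\Pi(\theta)$. Suppose that the point $t\in[0,1]$ satisfies $\psi_j(t)=1$ for all $j\ge1$, and put $$R_n^{\mathrm{loc}}(\theta_0,t)=\mathbb E_0^{(n)}\Bigl(\sum_{j\ge1}\psi_j(t)(\hat\theta_{nj}-\theta_{0j})\Bigr)^2 .$$ Then the following hold. (1) For all $n\ge1$ and $\theta_0\in\Theta_\beta(L_0)$, almost surely the posterior is a well-defined probability measure, each of its coordinate means exists, and the series in $R_n^{\mathrm{loc}}$ converges absolutely. (2) There is a constant $c>0$, not depending on $n$, such that for all sufficiently large $n$ $$\sup_{\theta_0\in\Theta_\beta(L_0)}R_n^{\mathrm{loc}}(\theta_0,t)\ \ge\ c\,\frac{n^{-\frac{2\beta-1}{2\beta+1}}}{\log^2 n}.$$ (3) This is suboptimal by a power of $n$: there is a constant $C>0$, not depending on $n$, such that for all sufficiently large $n$ the minimax pointwise risk satisfies $$\inf_T\ \sup_{\theta_0\in\Theta_\beta(L_0)}\mathbb E_0^{(n)}\bigl(T(X)-\boldsymbol f_0(t)\bigr)^2\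 \le\ C\,n^{-\frac{2\beta-1}{2\beta}},$$ where $T$ ranges over all measurable real-valued functions of $X$ and $\boldsymbol f_0(t)=\sum_j\psi_j(t)\theta_{0j}$. -/

import Mathlib

open MeasureTheory ProbabilityTheory Filter
open scoped NNReal ENNReal

/-! Sequences are indexed by `ℕ` starting at `0`: the index `j : ℕ` stands for the coordinate
number `j + 1` of the mathematical text. -/

namespace SieveWhiteNoise

noncomputable section

/-- `ψ` (the functions `ψ₁, ψ₂, …`) is an orthonormal basis of `L²(0,1)`; its members are functions
and not classes, so that they have values at points. -/
structure IsOrthonormalBasisL2 (ψ : ℕ → ℝ → ℝ) : Prop where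
  memLp : ∀ j, MemLp (ψ j) 2 (volume.restrict (Set.Icc (0 : ℝ) 1))
  orthonormal : ∀ i j, ∫ x in Set.Icc (0 : ℝ) 1, ψ i x * ψ j x = if i = j then 1 else 0
  complete : ∀ f : ℝ → ℝ, MemLp f 2 (volume.restrict (Set.Icc (0 : ℝ) 1)) →
    (∀ j, ∫ x in Set.Icc (0 : ℝ) 1, f x * ψ j x = 0) →
      f =ᵐ[volume.restrict (Set.Icc (0 : ℝ) 1)] 0

/-- The Sobolev class `Θ_β(L₀)`: sequences with `∑_{j ≥ 1} θ_j² j^{2β} < L₀`. -/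
def sobolevClass (β L₀ : ℝ) : Set (ℕ → ℝ) :=
  {θ | Summable (fun j : ℕ => θ j ^ 2 * ((j : ℝ) + 1) ^ (2 * β)) ∧
    ∑' j : ℕ, θ j ^ 2 * ((j : ℝ) + 1) ^ (2 * β) < L₀}

/-- The white noise model at noise level `1/√n`, in coordinates: the law of
`X_j = θ_j + ξ_j / √n`, `j ≥ 1`, with independent standard Gaussian `ξ_j`. -/
def whiteNoiseLaw (n : ℕ) (θ : ℕ → ℝ) : Measure (ℕ → ℝ) :=
  Measure.infinitePi fun j => gaussianReal (θ j) ((n : ℝ≥0)⁻¹)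

/-- The density of the model at `θ` with respect to the model at `0`:
`exp (n ⟨θ, X⟩ - (n / 2) ‖θ‖²)`. It is used for `θ` with finitely many nonzero coordinates. -/
def likelihood (n : ℕ) (X θ : ℕ → ℝ) : ℝ :=
  Real.exp ((n : ℝ) * ∑' j, θ j * X j - (n : ℝ) / 2 * ∑' j, θ j ^ 2)

/-- The Gaussian prior of the sieve of dimension `k`: independent coordinates, the `j`-th one
`N(0, τ_j²)` for `j ≤ k` and equal to `0` for `j > k` (`gaussianReal 0 0` is the point mass
at `0`). Here `v` is the sequence of the `τ_j²`. -/
def gaussianSieve (v : ℕ → ℝ≥0) (k : ℕ) : Measure (ℕ → ℝ) :=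
  Measure.infinitePi fun j => gaussianReal 0 (if j < k then v j else 0)

/-- The sieve prior `∑_k π(k) Π_k` with Gaussian `Π_k`. -/
def sievePrior (π : Measure ℕ) (v : ℕ → ℝ≥0) : Measure (ℕ → ℝ) :=
  Measure.sum fun k => π {k} • gaussianSieve v k

/-- The variances `τ_j² = τ₀ j^{-2q}`, `j ≥ 1`. -/
def priorVar (τ₀ q : ℝ) (j : ℕ) : ℝ≥0 :=
  Real.toNNReal (τ₀ * ((j : ℝ) + 1) ^ (-(2 * q)))

/-- The posterior distribution given `X`, by Bayes' formula. -/
def posteriorDist (n : ℕ) (Q : Measure (ℕ → ℝ)) (X : ℕ → ℝ) : Measure (ℕ → ℝ) :=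
  (∫⁻ θ, ENNReal.ofReal (likelihood n X θ) ∂Q)⁻¹ •
    Q.withDensity fun θ => ENNReal.ofReal (likelihood n X θ)

/-- The Bayes estimate: the posterior mean, coordinate by coordinate. -/
def posteriorMean (n : ℕ) (Q : Measure (ℕ → ℝ)) (X : ℕ → ℝ) (j : ℕ) : ℝ :=
  ∫ θ, θ j ∂(posteriorDist n Q X)

/-- The pointwise squared-error risk at `t` of the estimator of `f` with the basis coefficients
`est X`, when `f` has the coefficients `θ₀`; `a j` is the value at `t` of the `j`-th
basis function. -/
def pointwiseRisk (n : ℕ) (a : ℕ → ℝ) (est : (ℕ → ℝ) → ℕ → ℝ) (θ₀ : ℕ → ℝ) : ℝ≥0∞ :=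
  ∫⁻ X, ENNReal.ofReal ((∑' j, a j * (est X j - θ₀ j)) ^ 2) ∂(whiteNoiseLaw n θ₀)

/-- The minimax squared-error risk over `S` for the estimation of `f(t) = ∑_j a_j θ_j`, over all
estimators of that number. -/
def minimaxPointwiseRisk (n : ℕ) (a : ℕ → ℝ) (S : Set (ℕ → ℝ)) : ℝ≥0∞ :=
  ⨅ (T : (ℕ → ℝ) → ℝ) (_ : Measurable T), ⨆ θ₀ ∈ S,
    ∫⁻ X, ENNReal.ofReal ((T X - ∑' j, a j * θ₀ j) ^ 2) ∂(whiteNoiseLaw n θ₀)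

end

end SieveWhiteNoise

open SieveWhiteNoise

namespace SieveWhiteNoise

noncomputable section

/-! The lower bound is a bias effect. The Poisson weights of the dimension `k` decay faster than any
geometric sequence, whereas coordinates at the noise level earn only a likelihood gain that is
geometric in `k`, in a suitable mean sense. Take `m ≈ n ^ (1 / (2β + 1))` coordinates equal to `η /
√n`: this is as many as the Sobolev class allows, and since all basis functions equal `1` at `t`
they add up to `f = m η / √n`, with `f²` of the claimed order. The sieves of dimension beyond `J =
⌊b m⌋`, with a small `b` that does not depend on `n`, contribute an amount exponentially small in
`J`. The first `J` coordinates contribute to `∑ |θ̂_j|` a mean of order `J / √n`, a small fraction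
of `f`. So the posterior mean misses most of `f`. No logarithm is lost: `iSup_pointwiseRisk_ge` is
the bound without `log² n`.

The obstacle is integrability. The available bound for the evidence of one coordinate is `exp (n x²
/ 2)`, whose mean under a Gaussian of variance `1/n` is infinite. But a posterior weight is at most
`1`, hence at most the square root of any upper bound for it (`inv_evidence_mul_le`). This halves
the exponent, and `3/8` remains after the bound for the coordinates is included.
`tsum_enorm_posteriorMean_le` collects the result, and `pointwiseRisk_ge` needs only its first
moment.

The same square root trick shows that the evidence is almost surely finite, which gives (1). For
(3), summing the first `⌈n ^ (1 / (2β))⌉` observations balances variance against squared bias. -/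

/-! ### Conjugate computations in one coordinate. -/

/-- The variance of a Gaussian posterior with prior `N(0, v)` and noise variance `1/n`. -/
def shrunkVar (n : ℕ) (v : ℝ≥0) : ℝ≥0 := v / (1 + n * v)

/-- The likelihood factor of one coordinate. -/
def coordLikelihood (n : ℕ) (x θ : ℝ) : ℝ≥0∞ :=
  ENNReal.ofReal (Real.exp ((n : ℝ) * (θ * x) - (n : ℝ) / 2 * θ ^ 2))

/-- The marginal likelihood of one coordinate under the prior `N(0, v)`. -/
def coordEvidence (n : ℕ) (v : ℝ≥0) (x : ℝ) : ℝ≥0∞ :=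
  ∫⁻ θ, coordLikelihood n x θ ∂(gaussianReal 0 v)

lemma measurable_coordLikelihood (n : ℕ) (x : ℝ) : Measurable (coordLikelihood n x) := by
  unfold coordLikelihood; fun_prop

lemma shrunkVar_ne_zero {n : ℕ} {v : ℝ≥0} (hv : v ≠ 0) : shrunkVar n v ≠ 0 := by
  unfold shrunkVar; positivity

/-- The normalizing constant of the tilted Gaussian. -/
def tiltConst (n : ℕ) (v : ℝ≥0) (x : ℝ) : ℝ :=
  (√(1 + n * v))⁻¹ * Real.exp ((n : ℝ) ^ 2 * shrunkVar n v * x ^ 2 / 2)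

/-- Conjugacy: completing the square in `θ`. -/
lemma gaussianPDFReal_mul_exp {n : ℕ} {v : ℝ≥0} (hv : v ≠ 0) (x θ : ℝ) :
    gaussianPDFReal 0 v θ * Real.exp ((n : ℝ) * (θ * x) - (n : ℝ) / 2 * θ ^ 2) =
      tiltConst n v x * gaussianPDFReal (n * shrunkVar n v * x) (shrunkVar n v) θ := by
  have hv' : (0 : ℝ) < v := by positivity
  have h1 : (0 : ℝ) < 1 + n * v := by positivity
  have hw : ((shrunkVar n v : ℝ≥0) : ℝ) = v / (1 + n * v) := by simp [shrunkVar]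
  have hs : √(2 * Real.pi * v) = √(1 + n * v) * √(2 * Real.pi * (v / (1 + n * v))) := by
    rw [← Real.sqrt_mul h1.le]; congr 1; field_simp
  simp only [gaussianPDFReal, tiltConst, hw, hs, mul_inv]
  have he : Real.exp (-(θ - 0) ^ 2 / (2 * v)) * Real.exp (n * (θ * x) - n / 2 * θ ^ 2) =
      Real.exp (n ^ 2 * (v / (1 + n * v)) * x ^ 2 / 2) *
        Real.exp (-(θ - n * (v / (1 + n * v)) * x) ^ 2 / (2 * (v / (1 + n * v)))) := by
    rw [← Real.exp_add, ← Real.exp_add]; congr 1; field_simp; ring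
  linear_combination (√(1 + n * v))⁻¹ * (√(2 * Real.pi * (v / (1 + n * v))))⁻¹ * he

lemma lintegral_mul_coordLikelihood {n : ℕ} {v : ℝ≥0} (hv : v ≠ 0) (x : ℝ) {g : ℝ → ℝ≥0∞}
    (hg : Measurable g) :
    ∫⁻ θ, g θ * coordLikelihood n x θ ∂(gaussianReal 0 v) =
      ENNReal.ofReal (tiltConst n v x) *
        ∫⁻ θ, g θ ∂(gaussianReal (n * shrunkVar n v * x) (shrunkVar n v)) := by
  rw [gaussianReal_of_var_ne_zero _ hv, gaussianReal_of_var_ne_zero _ (shrunkVar_ne_zero hv),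
    lintegral_withDensity_eq_lintegral_mul (g := fun θ => g θ * coordLikelihood n x θ) _
      (measurable_gaussianPDF _ _) (hg.mul (measurable_coordLikelihood n x)),
    lintegral_withDensity_eq_lintegral_mul _ (measurable_gaussianPDF _ _) hg,
    ← lintegral_const_mul _ ((measurable_gaussianPDF _ _).mul hg)]
  refine lintegral_congr fun θ => ?_
  simp only [Pi.mul_apply, gaussianPDF, coordLikelihood]
  have h := gaussianPDFReal_mul_exp (n := n) hv x θ
  have h0 : 0 ≤ tiltConst n v x := by unfold tiltConst; positivity
  rw [mul_left_comm, ← ENNReal.ofReal_mul (gaussianPDFReal_nonneg _ _ _), h,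
    ENNReal.ofReal_mul h0]
  ring

lemma coordEvidence_eq {n : ℕ} {v : ℝ≥0} (hv : v ≠ 0) (x : ℝ) :
    coordEvidence n v x = ENNReal.ofReal (tiltConst n v x) := by
  have := lintegral_mul_coordLikelihood (n := n) hv x (g := fun _ => 1) measurable_const
  simpa [coordEvidence] using this

/-- The likelihood factor is largest at `θ = x`, so the bound is uniform in the prior variance. -/
lemma coordEvidence_le (n : ℕ) (v : ℝ≥0) (x : ℝ) :
    coordEvidence n v x ≤ ENNReal.ofReal (Real.exp (n * x ^ 2 / 2)) := by
  have : coordEvidence n v x ≤ ∫⁻ _, ENNReal.ofReal (Real.exp (n * x ^ 2 / 2))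
      ∂(gaussianReal 0 v) := by
    refine lintegral_mono fun θ => ENNReal.ofReal_le_ofReal (Real.exp_le_exp.2 ?_)
    nlinarith [mul_nonneg (Nat.cast_nonneg (α := ℝ) n) (sq_nonneg (θ - x))]
  simpa using this

lemma le_coordEvidence {n : ℕ} {v : ℝ≥0} (hv : v ≠ 0) (x : ℝ) :
    ENNReal.ofReal ((1 + n * v : ℝ)⁻¹) ≤ coordEvidence n v x := by
  rw [coordEvidence_eq hv]
  refine ENNReal.ofReal_le_ofReal ?_
  have h1 : (1 : ℝ) ≤ 1 + n * v := by
    have : (0 : ℝ) ≤ n * v := by positivity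
    linarith
  have h2 : √(1 + n * v : ℝ) ≤ 1 + n * v := Real.sqrt_le_self_iff.2 (Or.inr h1)
  have h3 : 1 ≤ Real.exp ((n : ℝ) ^ 2 * shrunkVar n v * x ^ 2 / 2) :=
    Real.one_le_exp (by positivity)
  have h4 : (1 + n * v : ℝ)⁻¹ ≤ (√(1 + n * v : ℝ))⁻¹ := by gcongr
  unfold tiltConst
  calc (1 + n * v : ℝ)⁻¹ ≤ (√(1 + n * v : ℝ))⁻¹ * 1 := by simpa using h4
    _ ≤ _ := by gcongr

lemma lintegral_enorm_gaussianReal_le (μ : ℝ) (w : ℝ≥0) {s : ℝ} (hs : 0 < s)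
    (hw : (w : ℝ) ≤ s ^ 2) :
    ∫⁻ θ, ‖θ‖ₑ ∂(gaussianReal μ w) ≤ ENNReal.ofReal (|μ| + s) := by
  have hm : MemLp (fun θ : ℝ => θ - μ) 2 (gaussianReal μ w) :=
    (memLp_id_gaussianReal' 2 (by simp)).sub (memLp_const μ)
  have hi : Integrable (fun θ : ℝ => (θ - μ) ^ 2) (gaussianReal μ w) := hm.integrable_sq
  have hv : ∫ θ, (θ - μ) ^ 2 ∂(gaussianReal μ w) = w := by
    have := variance_fun_id_gaussianReal (μ := μ) (v := w)
    rw [variance_eq_integral (by fun_prop)] at this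
    simpa using this
  have hI : Integrable (fun θ : ℝ => |μ| + (s / 2 + (2 * s)⁻¹ * (θ - μ) ^ 2))
      (gaussianReal μ w) := (integrable_const _).add ((integrable_const _).add (hi.const_mul _))
  calc ∫⁻ θ, ‖θ‖ₑ ∂(gaussianReal μ w)
      ≤ ∫⁻ θ, ENNReal.ofReal (|μ| + (s / 2 + (2 * s)⁻¹ * (θ - μ) ^ 2)) ∂(gaussianReal μ w) := by
        refine lintegral_mono fun θ => ?_
        rw [Real.enorm_eq_ofReal_abs]
        refine ENNReal.ofReal_le_ofReal ?_
        have h1 : |θ| ≤ |μ| + |θ - μ| := by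
          have := abs_add_le μ (θ - μ); simpa using this
        -- AM-GM at scale `s`: only the second moment has to be integrated.
        have h2 : |θ - μ| ≤ s / 2 + (2 * s)⁻¹ * (θ - μ) ^ 2 := by
          rw [← sq_abs (θ - μ)]
          have : s / 2 + (2 * s)⁻¹ * |θ - μ| ^ 2 - |θ - μ| = (2 * s)⁻¹ * (s - |θ - μ|) ^ 2 := by
            field_simp; ring
          have : 0 ≤ (2 * s)⁻¹ * (s - |θ - μ|) ^ 2 := by positivity
          linarith
        linarith
    _ = ENNReal.ofReal (∫ θ, (|μ| + (s / 2 + (2 * s)⁻¹ * (θ - μ) ^ 2)) ∂(gaussianReal μ w)) := by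
        rw [ofReal_integral_eq_lintegral_ofReal hI]
        exact ae_of_all _ fun θ => by positivity
    _ ≤ _ := by
        refine ENNReal.ofReal_le_ofReal ?_
        have hI2 : Integrable (fun θ : ℝ => s / 2 + (2 * s)⁻¹ * (θ - μ) ^ 2) (gaussianReal μ w) :=
          (integrable_const _).add (hi.const_mul _)
        rw [integral_add (integrable_const _) hI2,
          integral_add (integrable_const _) (hi.const_mul _), integral_const_mul, hv]
        simp only [integral_const, probReal_univ, smul_eq_mul, one_mul]
        have : (2 * s)⁻¹ * (w : ℝ) ≤ (2 * s)⁻¹ * s ^ 2 := by gcongr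
        have h3 : (2 * s)⁻¹ * s ^ 2 = s / 2 := by field_simp
        linarith

/-- A bound for the posterior mean of `|θ|` in one coordinate. -/
def coordBound (n : ℕ) (x : ℝ) : ℝ := |x| + (√n)⁻¹

/-- The tilted Gaussian has a mean obtained by shrinking `x` and a variance at most `1 / n`,
whatever `v` is. -/
lemma lintegral_enorm_mul_coordLikelihood_le {n : ℕ} (hn : 1 ≤ n) {v : ℝ≥0} (hv : v ≠ 0) (x : ℝ) :
    ∫⁻ θ, ‖θ‖ₑ * coordLikelihood n x θ ∂(gaussianReal 0 v) ≤
      coordEvidence n v x * ENNReal.ofReal (coordBound n x) := by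
  have hn' : (0 : ℝ) < n := by exact_mod_cast hn
  rw [lintegral_mul_coordLikelihood hv x measurable_enorm, coordEvidence_eq hv]
  have hv' : (0 : ℝ) < v := by positivity
  have hw : ((shrunkVar n v : ℝ≥0) : ℝ) = v / (1 + n * v) := by simp [shrunkVar]
  have h1 : (n : ℝ) * shrunkVar n v ≤ 1 := by
    rw [hw, ← mul_div_assoc, div_le_one (by positivity)]; linarith
  gcongr
  refine (lintegral_enorm_gaussianReal_le _ _ (s := (√n)⁻¹) (by positivity) ?_).trans ?_
  · rw [inv_pow, Real.sq_sqrt hn'.le, le_inv_comm₀ (by rw [hw]; positivity) hn',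
      ← one_div, le_div_iff₀ (by rw [hw]; positivity)]
    exact h1
  · refine ENNReal.ofReal_le_ofReal ?_
    unfold coordBound
    have : |(n : ℝ) * shrunkVar n v * x| ≤ 1 * |x| := by
      rw [abs_mul, abs_of_nonneg (by positivity : (0 : ℝ) ≤ n * shrunkVar n v)]
      gcongr
    linarith

/-! ### Exponential moments of one observation. -/

/-- The exponential weight `exp (n x² / 8)`. -/
def expWeight (n : ℕ) (x : ℝ) : ℝ≥0∞ := ENNReal.ofReal (Real.exp (n * x ^ 2 / 8))

lemma measurable_expWeight (n : ℕ) : Measurable (expWeight n) := by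
  unfold expWeight; fun_prop

lemma one_le_expWeight (n : ℕ) (x : ℝ) : 1 ≤ expWeight n x := by
  rw [expWeight, ENNReal.one_le_ofReal]; exact Real.one_le_exp (by positivity)

lemma coordEvidence_le_expWeight (n : ℕ) (v : ℝ≥0) (x : ℝ) :
    coordEvidence n v x ≤ expWeight n x ^ 4 := by
  refine (coordEvidence_le n v x).trans_eq ?_
  rw [expWeight, ← ENNReal.ofReal_pow (by positivity), ← Real.exp_nat_mul]
  congr 2; push_cast; ring

lemma coordBound_le {n : ℕ} (hn : 1 ≤ n) (x : ℝ) :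
    ENNReal.ofReal (coordBound n x) ≤ ENNReal.ofReal (3 * (√n)⁻¹) * expWeight n x := by
  have hn' : (0 : ℝ) < n := by exact_mod_cast hn
  rw [expWeight, ← ENNReal.ofReal_mul (by positivity)]
  refine ENNReal.ofReal_le_ofReal ?_
  unfold coordBound
  have hs : 0 < √(n : ℝ) := by positivity
  have h1 : |x| = (√(n : ℝ))⁻¹ * (√n * |x|) := by field_simp
  have h2 : (n : ℝ) * x ^ 2 / 8 = (√n * |x|) ^ 2 / 8 := by
    rw [mul_pow, Real.sq_sqrt hn'.le, sq_abs]
  have h3 := Real.add_one_le_exp ((√n * |x|) ^ 2 / 8)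
  rw [h2]
  set u := √(n : ℝ) * |x|
  rw [h1]
  have h4 : u + 1 ≤ 3 * Real.exp (u ^ 2 / 8) := by nlinarith [sq_nonneg (u - 4 / 3)]
  have := mul_le_mul_of_nonneg_left h4 (inv_nonneg.2 hs.le)
  linarith

/-- The exponent `3 n x² / 8` stays below the Gaussian decay `n x² / 2`, so the integrand is
dominated by a Gaussian density of eight times the variance; the leading `3` bounds `√8`. -/
lemma lintegral_expWeight_cube_le {n : ℕ} (hn : 1 ≤ n) {a A : ℝ} (hA : n * a ^ 2 ≤ A) :
    ∫⁻ x, expWeight n x ^ 3 ∂(gaussianReal a (n : ℝ≥0)⁻¹) ≤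
      ENNReal.ofReal (3 * Real.exp (3 * A)) := by
  have hn' : (0 : ℝ) < n := by exact_mod_cast hn
  have hn0 : (n : ℝ≥0) ≠ 0 := by positivity
  have hv : ((n : ℝ≥0)⁻¹) ≠ 0 := by positivity
  have hv8 : (8 * (n : ℝ≥0)⁻¹) ≠ 0 := by positivity
  rw [gaussianReal_of_var_ne_zero _ hv, lintegral_withDensity_eq_lintegral_mul _
    (measurable_gaussianPDF _ _) ((measurable_expWeight n).pow_const 3)]
  calc _ ≤ ∫⁻ x, ENNReal.ofReal (3 * Real.exp (3 * A)) * gaussianPDF a (8 * (n : ℝ≥0)⁻¹) x := by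
        refine lintegral_mono fun x => ?_
        simp only [Pi.mul_apply, gaussianPDF, expWeight]
        rw [← ENNReal.ofReal_pow (by positivity), ← Real.exp_nat_mul,
          ← ENNReal.ofReal_mul (gaussianPDFReal_nonneg _ _ _), ← ENNReal.ofReal_mul (by positivity)]
        refine ENNReal.ofReal_le_ofReal ?_
        simp only [gaussianPDFReal]
        push_cast
        have h8 : √(2 * Real.pi * (8 * (n : ℝ)⁻¹)) = √8 * √(2 * Real.pi * (n : ℝ)⁻¹) := by
          rw [← Real.sqrt_mul (by norm_num)]; congr 1; ring
        have h3 : √(8 : ℝ) ≤ 3 := by rw [Real.sqrt_le_left (by norm_num)]; norm_num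
        have hq : (√(2 * Real.pi * (n : ℝ)⁻¹))⁻¹ ≤ 3 * (√(2 * Real.pi * (8 * (n : ℝ)⁻¹)))⁻¹ := by
          have h80 : 0 < √(8 : ℝ) := by positivity
          have : (√(2 * Real.pi * (n : ℝ)⁻¹))⁻¹ = √8 * (√(2 * Real.pi * (8 * (n : ℝ)⁻¹)))⁻¹ := by
            rw [h8, mul_inv, ← mul_assoc, mul_inv_cancel₀ h80.ne', one_mul]
          rw [this]; gcongr
        have he : Real.exp (-(x - a) ^ 2 / (2 * (n : ℝ)⁻¹)) * Real.exp (3 * (n * x ^ 2 / 8)) ≤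
            Real.exp (3 * A) * Real.exp (-(x - a) ^ 2 / (2 * (8 * (n : ℝ)⁻¹))) := by
          rw [← Real.exp_add, ← Real.exp_add]
          refine Real.exp_le_exp.2 ?_
          have e1 : -(x - a) ^ 2 / (2 * (n : ℝ)⁻¹) = -(n * (x - a) ^ 2) / 2 := by field_simp
          have e2 : -(x - a) ^ 2 / (2 * (8 * (n : ℝ)⁻¹)) = -(n * (x - a) ^ 2) / 16 := by
            field_simp; ring
          rw [e1, e2]
          -- The worst case is `x - a = 6 a`, where the excess is `21 n a² / 8 ≤ 3 A`.
          nlinarith [mul_nonneg hn'.le (sq_nonneg (x - a - 6 * a)),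
            mul_nonneg hn'.le (sq_nonneg a)]
        calc _ = (√(2 * Real.pi * (n : ℝ)⁻¹))⁻¹ * (Real.exp (-(x - a) ^ 2 / (2 * (n : ℝ)⁻¹)) *
              Real.exp (3 * (n * x ^ 2 / 8))) := by ring
          _ ≤ (3 * (√(2 * Real.pi * (8 * (n : ℝ)⁻¹)))⁻¹) * (Real.exp (3 * A) *
              Real.exp (-(x - a) ^ 2 / (2 * (8 * (n : ℝ)⁻¹)))) := by gcongr
          _ = _ := by ring
    _ = _ := by
        rw [lintegral_const_mul _ (measurable_gaussianPDF _ _), lintegral_gaussianPDF_eq_one _ hv8,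
          mul_one]

/-! ### Evidence and posterior of the sieve mixture. -/

lemma lintegral_infinitePi_prod (μ : ℕ → Measure ℝ) [∀ i, IsProbabilityMeasure (μ i)]
    (s : Finset ℕ) {f : ℕ → ℝ → ℝ≥0∞} (hf : ∀ i, Measurable (f i)) :
    ∫⁻ x, ∏ i ∈ s, f i (x i) ∂(Measure.infinitePi μ) = ∏ i ∈ s, ∫⁻ x, f i x ∂(μ i) := by
  rw [lintegral_prod_eq_prod_lintegral_of_indepFun s (fun i (x : ℕ → ℝ) => f i (x i))
    (iIndepFun_infinitePi hf) (fun i => (hf i).comp (measurable_pi_apply i))]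
  refine Finset.prod_congr rfl fun i _ => ?_
  exact (measurePreserving_eval_infinitePi μ i).lintegral_comp (hf i)

/-- The marginal likelihood under the Gaussian prior of the sieve of dimension `k`. -/
def sieveEvidence (n : ℕ) (v : ℕ → ℝ≥0) (k : ℕ) (X : ℕ → ℝ) : ℝ≥0∞ :=
  ∏ i ∈ Finset.range k, coordEvidence n (v i) (X i)

/-- The marginal likelihood. -/
def evidence (n : ℕ) (Q : Measure (ℕ → ℝ)) (X : ℕ → ℝ) : ℝ≥0∞ :=
  ∫⁻ θ, ENNReal.ofReal (likelihood n X θ) ∂Q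

/-- The sum of the bounds `coordBound` of the first `k` coordinates. -/
def sieveBound (n k : ℕ) (X : ℕ → ℝ) : ℝ≥0∞ :=
  ∑ i ∈ Finset.range k, ENNReal.ofReal (coordBound n (X i))

instance (v : ℕ → ℝ≥0) (k : ℕ) : IsProbabilityMeasure (gaussianSieve v k) := by
  unfold gaussianSieve; infer_instance

instance (n : ℕ) (θ : ℕ → ℝ) : IsProbabilityMeasure (whiteNoiseLaw n θ) := by
  unfold whiteNoiseLaw; infer_instance

lemma measurable_likelihood (n : ℕ) (X : ℕ → ℝ) : Measurable (likelihood n X) := by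
  unfold likelihood
  have h1 : Measurable fun θ : ℕ → ℝ => ∑' j, θ j * X j :=
    Measurable.tsum fun j => (measurable_pi_apply j).mul_const _
  have h2 : Measurable fun θ : ℕ → ℝ => ∑' j, θ j ^ 2 :=
    Measurable.tsum fun j => (measurable_pi_apply j).pow_const 2
  exact ((h1.const_mul _).sub (h2.const_mul _)).exp

lemma ae_gaussianSieve_eq_zero (v : ℕ → ℝ≥0) (k : ℕ) :
    ∀ᵐ θ ∂(gaussianSieve v k), ∀ j, k ≤ j → θ j = 0 := by
  rw [ae_all_iff]
  intro j
  by_cases hj : k ≤ j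
  · have hmp := measurePreserving_eval_infinitePi
      (fun j => gaussianReal 0 (if j < k then v j else 0)) j
    have h0 : ∀ᵐ x ∂(gaussianReal 0 (if j < k then v j else 0)), x = 0 := by
      rw [if_neg (not_lt.2 hj), gaussianReal_zero_var]
      simp
    filter_upwards [hmp.quasiMeasurePreserving.ae h0] with θ hθ _ using hθ
  · exact ae_of_all _ fun θ h => absurd h hj

lemma ofReal_likelihood_eq_prod (n : ℕ) (X : ℕ → ℝ) {θ : ℕ → ℝ} {k : ℕ}
    (hθ : ∀ j, k ≤ j → θ j = 0) :
    ENNReal.ofReal (likelihood n X θ) =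
      ∏ i ∈ Finset.range k, coordLikelihood n (X i) (θ i) := by
  have h0 : ∀ j ∉ Finset.range k, θ j = 0 := fun j hj => hθ j (by simpa using hj)
  unfold likelihood coordLikelihood
  rw [tsum_eq_sum (s := Finset.range k) (fun j hj => by simp [h0 j hj]),
    tsum_eq_sum (s := Finset.range k) (fun j hj => by simp [h0 j hj]),
    Finset.mul_sum, Finset.mul_sum, ← Finset.sum_sub_distrib, Real.exp_sum,
    ENNReal.ofReal_prod_of_nonneg fun i _ => (Real.exp_pos _).le]

lemma lintegral_likelihood_gaussianSieve (n : ℕ) (v : ℕ → ℝ≥0) (k : ℕ) (X : ℕ → ℝ) :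
    ∫⁻ θ, ENNReal.ofReal (likelihood n X θ) ∂(gaussianSieve v k) = sieveEvidence n v k X := by
  have h : ∫⁻ θ, ENNReal.ofReal (likelihood n X θ) ∂(gaussianSieve v k) =
      ∫⁻ θ, ∏ i ∈ Finset.range k, coordLikelihood n (X i) (θ i) ∂(gaussianSieve v k) :=
    lintegral_congr_ae <| by
      filter_upwards [ae_gaussianSieve_eq_zero v k] with θ hθ using ofReal_likelihood_eq_prod n X hθ
  rw [h, gaussianSieve, lintegral_infinitePi_prod _ _ fun i => measurable_coordLikelihood n (X i)]
  refine Finset.prod_congr rfl fun i hi => ?_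
  rw [if_pos (Finset.mem_range.1 hi), coordEvidence]

lemma lintegral_likelihood_mul_enorm_gaussianSieve_le {n : ℕ} (hn : 1 ≤ n) {v : ℕ → ℝ≥0}
    (hv : ∀ i, v i ≠ 0) (k : ℕ) (X : ℕ → ℝ) (j : ℕ) :
    ∫⁻ θ, ENNReal.ofReal (likelihood n X θ) * ‖θ j‖ₑ ∂(gaussianSieve v k) ≤
      sieveEvidence n v k X * if j < k then ENNReal.ofReal (coordBound n (X j)) else 0 := by
  by_cases hj : j < k
  · have h : ∫⁻ θ, ENNReal.ofReal (likelihood n X θ) * ‖θ j‖ₑ ∂(gaussianSieve v k) =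
        ∫⁻ θ, ∏ i ∈ Finset.range k, ((if i = j then ‖θ i‖ₑ else 1) *
          coordLikelihood n (X i) (θ i)) ∂(gaussianSieve v k) :=
      lintegral_congr_ae <| by
        filter_upwards [ae_gaussianSieve_eq_zero v k] with θ hθ
        rw [ofReal_likelihood_eq_prod n X hθ, Finset.prod_mul_distrib, Finset.prod_ite_eq',
          if_pos (Finset.mem_range.2 hj), mul_comm]
    have hm : ∀ i, Measurable fun x : ℝ =>
        (if i = j then ‖x‖ₑ else 1) * coordLikelihood n (X i) x := by
      intro i
      refine Measurable.mul ?_ (measurable_coordLikelihood n (X i))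
      split_ifs
      exacts [measurable_enorm, measurable_const]
    rw [h, gaussianSieve, lintegral_infinitePi_prod _ _
      (f := fun i x => (if i = j then ‖x‖ₑ else 1) * coordLikelihood n (X i) x) hm, if_pos hj]
    calc _ ≤ ∏ i ∈ Finset.range k, (coordEvidence n (v i) (X i) *
          if i = j then ENNReal.ofReal (coordBound n (X i)) else 1) := by
          refine Finset.prod_le_prod' fun i hi => ?_
          rw [if_pos (Finset.mem_range.1 hi)]
          split_ifs with hij
          · exact lintegral_enorm_mul_coordLikelihood_le hn (hv i) (X i)
          · simp [coordEvidence]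
      _ = _ := by
          rw [Finset.prod_mul_distrib, Finset.prod_ite_eq', if_pos (Finset.mem_range.2 hj),
            sieveEvidence]
  · rw [if_neg hj, mul_zero, nonpos_iff_eq_zero]
    have : (fun θ => ENNReal.ofReal (likelihood n X θ) * ‖θ j‖ₑ) =ᵐ[gaussianSieve v k] 0 := by
      filter_upwards [ae_gaussianSieve_eq_zero v k] with θ hθ
      simp [hθ j (not_lt.1 hj)]
    rw [lintegral_congr_ae this]; simp

lemma lintegral_sievePrior (π : Measure ℕ) (v : ℕ → ℝ≥0) (f : (ℕ → ℝ) → ℝ≥0∞) :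
    ∫⁻ θ, f θ ∂(sievePrior π v) = ∑' k, π {k} * ∫⁻ θ, f θ ∂(gaussianSieve v k) := by
  rw [sievePrior, lintegral_sum_measure]
  simp

lemma evidence_sievePrior (n : ℕ) (π : Measure ℕ) (v : ℕ → ℝ≥0) (X : ℕ → ℝ) :
    evidence n (sievePrior π v) X = ∑' k, π {k} * sieveEvidence n v k X := by
  simp only [evidence, lintegral_sievePrior, lintegral_likelihood_gaussianSieve]

lemma lintegral_posteriorDist_le (n : ℕ) (Q : Measure (ℕ → ℝ)) (X : ℕ → ℝ)
    (f : (ℕ → ℝ) → ℝ≥0∞) :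
    ∫⁻ θ, f θ ∂(posteriorDist n Q X) ≤
      (evidence n Q X)⁻¹ * ∫⁻ θ, ENNReal.ofReal (likelihood n X θ) * f θ ∂Q := by
  rw [posteriorDist, lintegral_smul_measure, smul_eq_mul]
  exact mul_le_mul_right (lintegral_withDensity_le_lintegral_mul Q
    (measurable_likelihood n X).ennreal_ofReal f) _

/-- Exchanging the sums over coordinates and dimensions turns the left side into a posterior average
over `k` of `sieveBound n k X`. -/
lemma tsum_lintegral_enorm_posteriorDist_le {n : ℕ} (hn : 1 ≤ n) (π : Measure ℕ) {v : ℕ → ℝ≥0}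
    (hv : ∀ i, v i ≠ 0) (X : ℕ → ℝ) :
    ∑' j, ∫⁻ θ, ‖θ j‖ₑ ∂(posteriorDist n (sievePrior π v) X) ≤
      (evidence n (sievePrior π v) X)⁻¹ *
        ∑' k, π {k} * (sieveEvidence n v k X * sieveBound n k X) := by
  calc _ ≤ ∑' j, (evidence n (sievePrior π v) X)⁻¹ * ∑' k, π {k} * (sieveEvidence n v k X *
        if j < k then ENNReal.ofReal (coordBound n (X j)) else 0) := by
        refine ENNReal.tsum_le_tsum fun j => (lintegral_posteriorDist_le _ _ _ _).trans ?_
        rw [lintegral_sievePrior]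
        gcongr
        exact lintegral_likelihood_mul_enorm_gaussianSieve_le hn hv _ X j
    _ = _ := by
        rw [ENNReal.tsum_mul_left, ENNReal.tsum_comm]
        congr 2; ext k
        rw [ENNReal.tsum_mul_left, ENNReal.tsum_mul_left, sieveBound]
        congr 2
        rw [tsum_eq_sum (s := Finset.range k) (fun j hj => if_neg (by simpa using hj))]
        exact Finset.sum_congr rfl fun j hj => if_pos (Finset.mem_range.1 hj)

lemma enorm_posteriorMean_le (n : ℕ) (Q : Measure (ℕ → ℝ)) (X : ℕ → ℝ) (j : ℕ) :
    ‖posteriorMean n Q X j‖ₑ ≤ ∫⁻ θ, ‖θ j‖ₑ ∂(posteriorDist n Q X) :=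
  enorm_integral_le_lintegral_enorm _

lemma isProbabilityMeasure_posteriorDist {n : ℕ} {Q : Measure (ℕ → ℝ)} {X : ℕ → ℝ}
    (h0 : evidence n Q X ≠ 0) (h : evidence n Q X ≠ ∞) :
    IsProbabilityMeasure (posteriorDist n Q X) := by
  constructor
  rw [posteriorDist, Measure.smul_apply, withDensity_apply _ MeasurableSet.univ,
    Measure.restrict_univ, smul_eq_mul]
  exact ENNReal.inv_mul_cancel h0 h

/-! ### Light tails against geometric growth. -/

/-- The product of the weights `expWeight` of the first `k` coordinates. -/
def sieveWeight (n k : ℕ) (X : ℕ → ℝ) : ℝ≥0∞ := ∏ i ∈ Finset.range k, expWeight n (X i)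

lemma measurable_sieveWeight (n k : ℕ) : Measurable (sieveWeight n k) :=
  Finset.measurable_prod _ fun i _ => (measurable_expWeight n).comp (measurable_pi_apply i)

lemma one_le_sieveWeight (n k : ℕ) (X : ℕ → ℝ) : 1 ≤ sieveWeight n k X :=
  Finset.one_le_prod' fun i _ => one_le_expWeight n (X i)

lemma sieveEvidence_le (n : ℕ) (v : ℕ → ℝ≥0) (k : ℕ) (X : ℕ → ℝ) :
    sieveEvidence n v k X ≤ sieveWeight n k X ^ 4 := by
  rw [sieveEvidence, sieveWeight, ← Finset.prod_pow]
  exact Finset.prod_le_prod' fun i _ => coordEvidence_le_expWeight n (v i) (X i)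

lemma sieveBound_le {n : ℕ} (hn : 1 ≤ n) (k : ℕ) (X : ℕ → ℝ) :
    sieveBound n k X ≤ ENNReal.ofReal (3 * (√n)⁻¹) * k * sieveWeight n k X := by
  rw [sieveBound]
  have : ∀ i ∈ Finset.range k, ENNReal.ofReal (coordBound n (X i)) ≤
      ENNReal.ofReal (3 * (√n)⁻¹) * sieveWeight n k X := fun i hi => by
    refine (coordBound_le hn (X i)).trans (mul_le_mul_right ?_ _)
    exact Finset.single_le_prod' (f := fun i => expWeight n (X i))
      (fun i _ => one_le_expWeight n (X i)) hi
  refine (Finset.sum_le_sum this).trans_eq ?_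
  rw [Finset.sum_const, Finset.card_range, nsmul_eq_mul]; ring

lemma lintegral_sieveWeight_cube_le {n : ℕ} (hn : 1 ≤ n) {θ : ℕ → ℝ} {A : ℝ}
    (hA : ∀ j, n * θ j ^ 2 ≤ A) (k : ℕ) :
    ∫⁻ X, sieveWeight n k X ^ 3 ∂(whiteNoiseLaw n θ) ≤
      ENNReal.ofReal (3 * Real.exp (3 * A)) ^ k := by
  simp only [sieveWeight, ← Finset.prod_pow, whiteNoiseLaw]
  rw [lintegral_infinitePi_prod _ _ (f := fun _ x => expWeight n x ^ 3)
    fun _ => (measurable_expWeight n).pow_const 3]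
  refine (Finset.prod_le_prod' fun i _ => lintegral_expWeight_cube_le hn (hA i)).trans_eq ?_
  simp

lemma lintegral_coordBound_le {n : ℕ} (hn : 1 ≤ n) {θ : ℕ → ℝ} {A : ℝ}
    (hA : ∀ j, n * θ j ^ 2 ≤ A) (j : ℕ) :
    ∫⁻ X, ENNReal.ofReal (coordBound n (X j)) ∂(whiteNoiseLaw n θ) ≤
      ENNReal.ofReal (3 * (√n)⁻¹) * ENNReal.ofReal (3 * Real.exp (3 * A)) := by
  have hm := measurePreserving_eval_infinitePi
    (fun j => gaussianReal (θ j) ((n : ℝ≥0)⁻¹)) j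
  calc _ ≤ ∫⁻ X, ENNReal.ofReal (3 * (√n)⁻¹) * expWeight n (X j) ^ 3 ∂(whiteNoiseLaw n θ) := by
        refine lintegral_mono fun X => (coordBound_le hn (X j)).trans (mul_le_mul_right ?_ _)
        exact le_self_pow (one_le_expWeight n _) (by norm_num)
    _ = ENNReal.ofReal (3 * (√n)⁻¹) *
          ∫⁻ x, expWeight n x ^ 3 ∂(gaussianReal (θ j) ((n : ℝ≥0)⁻¹)) := by
        have hm' : Measurable fun X : ℕ → ℝ => expWeight n (X j) ^ 3 :=
          ((measurable_expWeight n).comp (measurable_pi_apply j)).pow_const 3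
        rw [lintegral_const_mul _ hm']
        congr 1
        exact hm.lintegral_comp ((measurable_expWeight n).pow_const 3)
    _ ≤ _ := mul_le_mul_right (lintegral_expWeight_cube_le hn (hA j)) _

/-- The weights of `π` decrease faster than any geometric sequence. The bound is written as a
square because its square root is what is used. -/
def HasLightTail (π : Measure ℕ) : Prop :=
  ∀ A : ℝ, 0 < A → ∃ D : ℝ, 0 < D ∧ ∀ k, π {k} ≤ ENNReal.ofReal (D * A⁻¹ ^ k) ^ 2

/-- An upper bound for the contribution of the sieve of dimension `k`. -/
def sieveTerm (D M : ℝ) (n k : ℕ) (X : ℕ → ℝ) : ℝ≥0∞ :=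
  ENNReal.ofReal (D * (8 * M)⁻¹ ^ k) * 4 ^ k * sieveWeight n k X ^ 3

lemma measurable_sieveTerm (D M : ℝ) (n k : ℕ) : Measurable (sieveTerm D M n k) :=
  ((measurable_sieveWeight n k).pow_const 3).const_mul _

/-- The factor `8 * M` is spent as `M` for the mean of the cubed weight of each coordinate, `4` for
factors linear in `k`, and `2` for a convergent geometric series. -/
lemma lintegral_tsum_sieveTerm_le {D M A : ℝ} (hD : 0 < D) (hM : M = 3 * Real.exp (3 * A)) {n : ℕ}
    (hn : 1 ≤ n) {θ : ℕ → ℝ} (hA : ∀ j, n * θ j ^ 2 ≤ A) (J : ℕ) :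
    ∫⁻ X, ∑' k, sieveTerm D M n (k + J) X ∂(whiteNoiseLaw n θ) ≤
      ENNReal.ofReal (2 * D * 2⁻¹ ^ J) := by
  have hM0 : 0 < M := by rw [hM]; positivity
  have h : ∀ k, ∫⁻ X, sieveTerm D M n k X ∂(whiteNoiseLaw n θ) ≤ ENNReal.ofReal (D * 2⁻¹ ^ k) := by
    intro k
    unfold sieveTerm
    rw [lintegral_const_mul _ ((measurable_sieveWeight n k).pow_const 3)]
    refine (mul_le_mul_right (lintegral_sieveWeight_cube_le hn hA k) _).trans_eq ?_
    have h4 : (4 : ℝ≥0∞) = ENNReal.ofReal 4 := by simp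
    rw [← hM, h4, ← ENNReal.ofReal_pow (by norm_num), ← ENNReal.ofReal_pow hM0.le,
      ← ENNReal.ofReal_mul (by positivity), ← ENNReal.ofReal_mul (by positivity)]
    congr 1
    rw [mul_assoc, mul_assoc, ← mul_pow, ← mul_pow]
    congr 2; field_simp; norm_num
  rw [lintegral_tsum fun k => (measurable_sieveTerm D M n (k + J)).aemeasurable]
  refine (ENNReal.tsum_le_tsum fun k => h (k + J)).trans_eq ?_
  have hs : Summable fun k : ℕ => D * (2⁻¹ : ℝ) ^ (k + J) := by
    simp only [pow_add]
    exact ((summable_geometric_of_lt_one (by norm_num) (by norm_num)).mul_right _).mul_left _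
  rw [← ENNReal.ofReal_tsum_of_nonneg (fun k => by positivity) hs, tsum_mul_left]
  simp only [pow_add]
  rw [tsum_mul_right, tsum_geometric_of_lt_one (by norm_num) (by norm_num)]
  congr 1; norm_num; ring

lemma natCast_le_four_pow (k : ℕ) : (k : ℝ≥0∞) ≤ 4 ^ k := by
  have : k ≤ 4 ^ k := (Nat.lt_pow_self (by norm_num)).le
  exact_mod_cast this

lemma one_add_three_mul_le_four_pow (k : ℕ) : (1 + 3 * k : ℝ≥0∞) ≤ 4 ^ k := by
  have : 1 + 3 * k ≤ 4 ^ k := by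
    induction k with
    | zero => simp
    | succ k ih => rw [pow_succ]; omega
  exact_mod_cast this

lemma tsum_le_sq_of_le_sq {t u : ℕ → ℝ≥0∞} (h : ∀ k, t k ≤ u k ^ 2) :
    ∑' k, t k ≤ (∑' k, u k) ^ 2 := by
  calc ∑' k, t k ≤ ∑' k, u k * ∑' i, u i := ENNReal.tsum_le_tsum fun k => (h k).trans <| by
        rw [sq]; exact mul_le_mul_right (ENNReal.le_tsum k) _
    _ = _ := by rw [ENNReal.tsum_mul_right, sq]

/-- `sieveWeight ^ 4` has the critical exponent `n x² / 2` and is not integrable. Its square root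
is, and a sum of squares is at most the square of the sum. -/
lemma tsum_evidence_le_sq {π : Measure ℕ} {D M : ℝ}
    (hπ : ∀ k, π {k} ≤ ENNReal.ofReal (D * (8 * M)⁻¹ ^ k) ^ 2) {n : ℕ} (hn : 1 ≤ n)
    (v : ℕ → ℝ≥0) (X : ℕ → ℝ) :
    ∑' k, π {k} * (sieveEvidence n v k X * (1 + sieveBound n k X)) ≤
      (∑' k, sieveTerm D M n k X) ^ 2 := by
  refine tsum_le_sq_of_le_sq fun k => ?_
  have hn' : (1 : ℝ) ≤ n := by exact_mod_cast hn
  have h3 : ENNReal.ofReal (3 * (√n)⁻¹) ≤ 3 := by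
    refine (ENNReal.ofReal_le_ofReal (q := 3) ?_).trans_eq (by simp)
    have : (√(n : ℝ))⁻¹ ≤ 1 := inv_le_one_of_one_le₀ (Real.one_le_sqrt.2 hn')
    linarith
  have hw := one_le_sieveWeight n k X
  have h1 : 1 + sieveBound n k X ≤ 4 ^ k * sieveWeight n k X := by
    calc 1 + sieveBound n k X ≤ sieveWeight n k X + 3 * k * sieveWeight n k X := by
          refine add_le_add hw ((sieveBound_le hn k X).trans ?_)
          gcongr
      _ = (1 + 3 * k) * sieveWeight n k X := by ring
      _ ≤ _ := by gcongr; exact one_add_three_mul_le_four_pow k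
  calc _ ≤ ENNReal.ofReal (D * (8 * M)⁻¹ ^ k) ^ 2 *
        (sieveWeight n k X ^ 4 * (4 ^ k * sieveWeight n k X)) := by
        gcongr
        exacts [hπ k, sieveEvidence_le n v k X]
    _ ≤ ENNReal.ofReal (D * (8 * M)⁻¹ ^ k) ^ 2 *
        (sieveWeight n k X ^ 4 * ((4 ^ k) ^ 2 * sieveWeight n k X ^ 2)) := by
        have h4 : (4 ^ k : ℝ≥0∞) ≤ (4 ^ k) ^ 2 :=
          le_self_pow (one_le_pow₀ (by norm_num)) (by norm_num)
        have h5 : sieveWeight n k X ≤ sieveWeight n k X ^ 2 := le_self_pow hw (by norm_num)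
        exact mul_le_mul_right (mul_le_mul_right (mul_le_mul' h4 h5) _) _
    _ = _ := by rw [sieveTerm]; ring

lemma ae_tsum_evidence_ne_top {π : Measure ℕ} (hπ : HasLightTail π) {n : ℕ} (hn : 1 ≤ n)
    (v : ℕ → ℝ≥0) {θ : ℕ → ℝ} {A : ℝ} (hA : ∀ j, n * θ j ^ 2 ≤ A) :
    ∀ᵐ X ∂(whiteNoiseLaw n θ),
      ∑' k, π {k} * (sieveEvidence n v k X * (1 + sieveBound n k X)) ≠ ∞ := by
  obtain ⟨D, hD, h⟩ := hπ (8 * (3 * Real.exp (3 * A))) (by positivity)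
  have hlt : ∀ᵐ X ∂(whiteNoiseLaw n θ), ∑' k, sieveTerm D (3 * Real.exp (3 * A)) n k X < ∞ := by
    refine ae_lt_top (Measurable.tsum fun k => measurable_sieveTerm _ _ n k) (ne_top_of_le_ne_top
      ?_ (lintegral_tsum_sieveTerm_le hD rfl hn hA 0))
    exact ENNReal.ofReal_ne_top
  filter_upwards [hlt] with X hX
  exact ne_top_of_le_ne_top (ENNReal.pow_ne_top hX.ne) (tsum_evidence_le_sq h hn v X)

/-! ### Almost sure regularity of the posterior. -/

/-- Only `k = 1` is kept, because `k = 0` has no mass under the conditioned prior. The bound holds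
for every `X`. -/
lemma le_evidence (n : ℕ) (π : Measure ℕ) {v : ℕ → ℝ≥0} (hv : ∀ i, v i ≠ 0) (X : ℕ → ℝ) :
    π {1} * ENNReal.ofReal ((1 + n * v 0 : ℝ)⁻¹) ≤ evidence n (sievePrior π v) X := by
  rw [evidence_sievePrior]
  refine le_trans ?_ (ENNReal.le_tsum 1)
  rw [sieveEvidence, Finset.prod_range_one]
  exact mul_le_mul_right (le_coordEvidence (hv 0) (X 0)) _

lemma evidence_ne_zero {n : ℕ} {π : Measure ℕ} (hπ1 : π {1} ≠ 0) {v : ℕ → ℝ≥0}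
    (hv : ∀ i, v i ≠ 0) (X : ℕ → ℝ) : evidence n (sievePrior π v) X ≠ 0 := by
  refine (lt_of_lt_of_le (pos_iff_ne_zero.2 ?_) (le_evidence n π hv X)).ne'
  refine mul_ne_zero hπ1 ?_
  have : 0 < (1 + n * v 0 : ℝ)⁻¹ := by positivity
  simpa using this

lemma ae_posterior_regular {π : Measure ℕ} (hπ1 : π {1} ≠ 0) (hπ : HasLightTail π) {n : ℕ}
    (hn : 1 ≤ n) {v : ℕ → ℝ≥0} (hv : ∀ i, v i ≠ 0) {θ : ℕ → ℝ} {A : ℝ}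
    (hA : ∀ j, n * θ j ^ 2 ≤ A) :
    ∀ᵐ X ∂(whiteNoiseLaw n θ),
      IsProbabilityMeasure (posteriorDist n (sievePrior π v) X) ∧
        ∑' j, ∫⁻ θ, ‖θ j‖ₑ ∂(posteriorDist n (sievePrior π v) X) ≠ ∞ := by
  filter_upwards [ae_tsum_evidence_ne_top hπ hn v hA] with X hX
  have h0 := evidence_ne_zero (n := n) hπ1 hv X
  constructor
  · refine isProbabilityMeasure_posteriorDist h0 (ne_top_of_le_ne_top hX ?_)
    rw [evidence_sievePrior]
    refine ENNReal.tsum_le_tsum fun k => mul_le_mul_right ?_ _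
    exact le_mul_of_one_le_right' le_self_add
  · refine ne_top_of_le_ne_top (ENNReal.mul_ne_top (ENNReal.inv_ne_top.2 h0) hX)
      ((tsum_lintegral_enorm_posteriorDist_le hn π hv X).trans ?_)
    gcongr
    exact le_add_self

lemma summable_of_tsum_enorm_ne_top {f : ℕ → ℝ} (h : ∑' j, ‖f j‖ₑ ≠ ∞) : Summable f := by
  refine Summable.of_norm ?_
  simpa using ENNReal.summable_toReal h

/-! ### The absolute sum of the posterior means. -/

/-- Here `z` stands for the inverse evidence. A posterior weight bounded by both `1` and `s²` is
bounded by `s`, which contains only `sieveWeight ^ 2`; the bound for the coordinates adds one more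
power. -/
lemma inv_evidence_mul_le {π : Measure ℕ} {D M : ℝ} {k : ℕ}
    (hπ : π {k} ≤ ENNReal.ofReal (D * (8 * M)⁻¹ ^ k) ^ 2) {n : ℕ} (hn : 1 ≤ n)
    (v : ℕ → ℝ≥0) {κ z : ℝ≥0∞} (X : ℕ → ℝ) (hz : z ≤ κ ^ 2)
    (hp : z * (π {k} * sieveEvidence n v k X) ≤ 1) :
    z * (π {k} * (sieveEvidence n v k X * sieveBound n k X)) ≤
      κ * ENNReal.ofReal (3 * (√n)⁻¹) * sieveTerm D M n k X := by
  obtain ⟨s, hs⟩ : ∃ s, s = κ * (ENNReal.ofReal (D * (8 * M)⁻¹ ^ k) * sieveWeight n k X ^ 2) :=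
    ⟨_, rfl⟩
  have hps : z * (π {k} * sieveEvidence n v k X) ≤ s := by
    have h2 : z * (π {k} * sieveEvidence n v k X) ≤ s ^ 2 := by
      calc _ ≤ κ ^ 2 * (ENNReal.ofReal (D * (8 * M)⁻¹ ^ k) ^ 2 * sieveWeight n k X ^ 4) :=
            mul_le_mul' hz (mul_le_mul' hπ (sieveEvidence_le n v k X))
        _ = s ^ 2 := by rw [hs]; ring
    rcases le_total s 1 with h | h
    · exact h2.trans (pow_le_of_le_one zero_le h (by norm_num))
    · exact hp.trans h
  have hb : sieveBound n k X ≤ ENNReal.ofReal (3 * (√n)⁻¹) * 4 ^ k * sieveWeight n k X :=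
    (sieveBound_le hn k X).trans
      (mul_le_mul_left (mul_le_mul_right (natCast_le_four_pow k) _) _)
  calc _ = z * (π {k} * sieveEvidence n v k X) * sieveBound n k X := by ring
    _ ≤ s * (ENNReal.ofReal (3 * (√n)⁻¹) * 4 ^ k * sieveWeight n k X) := mul_le_mul' hps hb
    _ = _ := by rw [hs, sieveTerm]; ring

/-- Below dimension `J` the weights sum to at most `1` and `sieveBound` increases with the
dimension; from `J` on, each term is estimated by the square root trick. -/
lemma mul_tsum_evidence_le {π : Measure ℕ} {D M : ℝ}
    (hπ : ∀ k, π {k} ≤ ENNReal.ofReal (D * (8 * M)⁻¹ ^ k) ^ 2) {n : ℕ} (hn : 1 ≤ n)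
    (v : ℕ → ℝ≥0) {κ z : ℝ≥0∞} (X : ℕ → ℝ) (hz : z ≤ κ ^ 2)
    (hp : ∑' k, z * (π {k} * sieveEvidence n v k X) ≤ 1) (J : ℕ) :
    z * ∑' k, π {k} * (sieveEvidence n v k X * sieveBound n k X) ≤
      sieveBound n J X + κ * ENNReal.ofReal (3 * (√n)⁻¹) * ∑' k, sieveTerm D M n (k + J) X := by
  have hsplit : _ = ∑' k, z * (π {k} * (sieveEvidence n v k X * sieveBound n k X)) :=
    Summable.sum_add_tsum_nat_add' (k := J) ENNReal.summable
  have h1 : ∑ k ∈ Finset.range J, z * (π {k} * (sieveEvidence n v k X * sieveBound n k X)) ≤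
      sieveBound n J X := by
    calc _ ≤ ∑ k ∈ Finset.range J, z * (π {k} * sieveEvidence n v k X) * sieveBound n J X := by
          refine Finset.sum_le_sum fun k hk => ?_
          rw [← mul_assoc, ← mul_assoc, mul_assoc z]
          refine mul_le_mul_right (Finset.sum_le_sum_of_subset ?_) _
          exact Finset.range_subset_range.2 (Finset.mem_range.1 hk).le
      _ ≤ 1 * sieveBound n J X := by
          rw [← Finset.sum_mul]
          exact mul_le_mul_left ((ENNReal.sum_le_tsum _).trans hp) _
      _ = _ := one_mul _
  have h2 : ∀ i, z * (π {i + J} * (sieveEvidence n v (i + J) X * sieveBound n (i + J) X)) ≤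
      κ * ENNReal.ofReal (3 * (√n)⁻¹) * sieveTerm D M n (i + J) X := fun i =>
    inv_evidence_mul_le (hπ _) hn v X hz ((ENNReal.le_tsum (i + J)).trans hp)
  refine (ENNReal.tsum_mul_left.symm.trans hsplit.symm).trans_le (add_le_add h1 ?_)
  exact (ENNReal.tsum_le_tsum h2).trans_eq ENNReal.tsum_mul_left

lemma tsum_enorm_posteriorMean_le {π : Measure ℕ} {D M : ℝ}
    (hπ : ∀ k, π {k} ≤ ENNReal.ofReal (D * (8 * M)⁻¹ ^ k) ^ 2) {n : ℕ} (hn : 1 ≤ n)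
    {v : ℕ → ℝ≥0} (hv : ∀ i, v i ≠ 0) {κ : ℝ≥0∞}
    (hκ : (π {1} * ENNReal.ofReal ((1 + n * v 0 : ℝ)⁻¹))⁻¹ ≤ κ ^ 2) (X : ℕ → ℝ) (J : ℕ) :
    ∑' j, ‖posteriorMean n (sievePrior π v) X j‖ₑ ≤
      sieveBound n J X + κ * ENNReal.ofReal (3 * (√n)⁻¹) * ∑' k, sieveTerm D M n (k + J) X := by
  have h := tsum_lintegral_enorm_posteriorDist_le hn π hv X
  have hz : (evidence n (sievePrior π v) X)⁻¹ ≤ κ ^ 2 :=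
    (ENNReal.inv_le_inv.2 (le_evidence n π hv X)).trans hκ
  have hp : ∑' k, (evidence n (sievePrior π v) X)⁻¹ * (π {k} * sieveEvidence n v k X) ≤ 1 := by
    rw [ENNReal.tsum_mul_left, ← evidence_sievePrior]
    -- An infinite evidence is covered: its inverse is `0`, and only total weight at most `1` is
    -- needed.
    exact ENNReal.inv_mul_le_one _
  exact (ENNReal.tsum_le_tsum fun j => enorm_posteriorMean_le n _ X j).trans
    (h.trans (mul_tsum_evidence_le hπ hn v X hz hp J))

/-! ### From a small first moment to a large risk. -/

/-- Integrate `(S - f)² ≥ f² - 2 f S`, where `S` is the sum of the estimates and is at most `U`.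
Putting the measurable `U` in the sum makes measurability of `est` unnecessary. -/
lemma pointwiseRisk_ge {n : ℕ} {est : (ℕ → ℝ) → ℕ → ℝ} {θ : ℕ → ℝ} (hθ : Summable θ)
    {f : ℝ} (hf : ∑' j, θ j = f) (hf0 : 0 < f) {U : (ℕ → ℝ) → ℝ≥0∞} (hU : Measurable U)
    (hest : ∀ X, ∑' j, ‖est X j‖ₑ ≤ U X)
    (hUf : ∫⁻ X, U X ∂(whiteNoiseLaw n θ) ≤ ENNReal.ofReal (f / 4)) :
    ENNReal.ofReal (f ^ 2 / 2) ≤ pointwiseRisk n (fun _ => 1) est θ := by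
  have key : ∀ X, ENNReal.ofReal (f ^ 2) ≤
      ENNReal.ofReal ((∑' j, 1 * (est X j - θ j)) ^ 2) + ENNReal.ofReal (2 * f) * U X := by
    intro X
    by_cases hX : U X = ∞
    -- Here the series of estimates need not converge, but the right side is infinite.
    · rw [hX, ENNReal.mul_top (by simpa using hf0)]; simp
    have hfin : ∑' j, ‖est X j‖ₑ ≠ ∞ := ne_top_of_le_ne_top hX (hest X)
    have hs := summable_of_tsum_enorm_ne_top hfin
    have hle : |∑' j, est X j| ≤ (U X).toReal := by
      have := ENNReal.toReal_mono hX (enorm_tsum_le_tsum_enorm.trans (hest X))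
      simpa using this
    simp only [one_mul]
    rw [hs.tsum_sub hθ, hf, ← ENNReal.ofReal_toReal hX, ← ENNReal.ofReal_mul (by positivity),
      ← ENNReal.ofReal_add (by positivity) (by positivity)]
    refine ENNReal.ofReal_le_ofReal ?_
    have h1 := (le_abs_self _).trans hle
    nlinarith [sq_nonneg (∑' j, est X j), mul_le_mul_of_nonneg_left h1 hf0.le]
  have hint := lintegral_mono (μ := whiteNoiseLaw n θ) key
  rw [lintegral_const, measure_univ, mul_one, lintegral_add_right _ (hU.const_mul _),
    lintegral_const_mul _ hU] at hint
  have h2 : ENNReal.ofReal (2 * f) * ∫⁻ X, U X ∂(whiteNoiseLaw n θ) ≤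
      ENNReal.ofReal (f ^ 2 / 2) := by
    refine (mul_le_mul_right hUf _).trans_eq ?_
    rw [← ENNReal.ofReal_mul (by positivity)]; congr 1; ring
  have h3 : ENNReal.ofReal (f ^ 2) ≤
      pointwiseRisk n (fun _ => 1) est θ + ENNReal.ofReal (f ^ 2 / 2) :=
    hint.trans (add_le_add le_rfl h2)
  have h4 : ENNReal.ofReal (f ^ 2) = ENNReal.ofReal (f ^ 2 / 2) + ENNReal.ofReal (f ^ 2 / 2) := by
    rw [← ENNReal.ofReal_add (by positivity) (by positivity)]; congr 1; ring
  rw [h4] at h3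
  exact (ENNReal.add_le_add_iff_right ENNReal.ofReal_ne_top).1 h3

lemma pointwiseRisk_posteriorMean_ge {π : Measure ℕ} {D M A : ℝ} (hD : 0 < D)
    (hM : M = 3 * Real.exp (3 * A)) (hπ : ∀ k, π {k} ≤ ENNReal.ofReal (D * (8 * M)⁻¹ ^ k) ^ 2)
    {n : ℕ} (hn : 1 ≤ n) {v : ℕ → ℝ≥0} (hv : ∀ i, v i ≠ 0) {κ : ℝ} (hκ0 : 0 ≤ κ)
    (hκ : (π {1} * ENNReal.ofReal ((1 + n * v 0 : ℝ)⁻¹))⁻¹ ≤ ENNReal.ofReal κ ^ 2)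
    {θ : ℕ → ℝ} (hA : ∀ j, n * θ j ^ 2 ≤ A) (hθ : Summable θ) {f : ℝ} (hf : ∑' j, θ j = f)
    (hf0 : 0 < f) (J : ℕ) (hJ : 3 * (√n)⁻¹ * (J * M + κ * (2 * D * 2⁻¹ ^ J)) ≤ f / 4) :
    ENNReal.ofReal (f ^ 2 / 2) ≤
      pointwiseRisk n (fun _ => 1) (posteriorMean n (sievePrior π v)) θ := by
  have hM0 : 0 < M := by rw [hM]; positivity
  have hc : ∀ j, Measurable fun X : ℕ → ℝ => ENNReal.ofReal (coordBound n (X j)) := by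
    intro j; unfold coordBound; fun_prop
  have hb : Measurable (sieveBound n J) := Finset.measurable_sum _ fun j _ => hc j
  have ht : Measurable fun X => ∑' k, sieveTerm D M n (k + J) X :=
    Measurable.tsum fun k => measurable_sieveTerm D M n (k + J)
  refine pointwiseRisk_ge hθ hf hf0 (hb.add (ht.const_mul _))
    (fun X => tsum_enorm_posteriorMean_le hπ hn hv hκ X J) ?_
  simp only [Pi.add_apply]
  rw [lintegral_add_left hb, lintegral_const_mul _ ht]
  refine le_trans ?_ (ENNReal.ofReal_le_ofReal hJ)
  simp only [sieveBound]
  rw [lintegral_finsetSum _ fun j _ => hc j]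
  refine (add_le_add (Finset.sum_le_sum fun j _ => lintegral_coordBound_le hn hA j)
    (mul_le_mul_right (lintegral_tsum_sieveTerm_le hD hM hn hA J) _)).trans_eq ?_
  rw [Finset.sum_const, Finset.card_range, nsmul_eq_mul, ← hM, ← ENNReal.ofReal_natCast,
    ← ENNReal.ofReal_mul (by positivity), ← ENNReal.ofReal_mul (by positivity),
    ← ENNReal.ofReal_mul (by positivity), ← ENNReal.ofReal_mul (by positivity),
    ← ENNReal.ofReal_add (by positivity) (by positivity)]
  congr 1; ring

/-! ### Sobolev tails and the truncated estimator. -/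

lemma antitoneOn_rpow_neg {a : ℝ} (ha : 0 ≤ a) {K : ℕ} (hK : 1 ≤ K) :
    AntitoneOn (fun x : ℝ => x ^ (-a)) (Set.Ici (K : ℝ)) := by
  intro x hx y _ hxy
  have hK' : (1 : ℝ) ≤ K := by exact_mod_cast hK
  have hx0 : 0 < x := lt_of_lt_of_le (by linarith) hx
  exact Real.rpow_le_rpow_of_nonpos hx0 hxy (by linarith)

lemma tsum_rpow_neg_le {a : ℝ} (ha : 1 < a) {K : ℕ} (hK : 1 ≤ K) :
    ∑' j : ℕ, (((j + K : ℕ) : ℝ) + 1) ^ (-a) ≤ (a - 1)⁻¹ * (K : ℝ) ^ (1 - a) := by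
  have hK' : (0 : ℝ) < K := by exact_mod_cast hK
  have h := AntitoneOn.tsum_comp_add_le_integral (f := fun x : ℝ => x ^ (-a)) K
    (antitoneOn_rpow_neg (by linarith) hK) (integrableOn_Ioi_rpow_of_lt (by linarith) hK')
    (fun t ht => Real.rpow_nonneg (hK'.le.trans (le_of_lt ht)) _)
  rw [integral_Ioi_rpow_of_lt (by linarith) hK'] at h
  have e : -(K : ℝ) ^ (-a + 1) / (-a + 1) = (a - 1)⁻¹ * (K : ℝ) ^ (1 - a) := by
    have h1 : -a + 1 = 1 - a := by ring
    have h2 : a - 1 ≠ 0 := by linarith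
    have h3 : (1 - a : ℝ) = -(a - 1) := by ring
    rw [h1, h3, neg_div_neg_eq, div_eq_inv_mul]
  rw [e] at h
  simpa using h

lemma summable_rpow_neg {a : ℝ} (ha : 1 < a) :
    Summable fun j : ℕ => ((j : ℝ) + 1) ^ (-a) := by
  have h := (summable_nat_add_iff 1).2 (Real.summable_nat_rpow.2 (by linarith : -a < -1))
  simpa using h

lemma abs_le_weighted {c x w : ℝ} (hc : 0 < c) (hw : 0 < w) :
    |x| ≤ (c * (x ^ 2 * w) + c⁻¹ * w⁻¹) / 2 := by
  have : c * (x ^ 2 * w) + c⁻¹ * w⁻¹ - 2 * |x| = c⁻¹ * w⁻¹ * (c * w * |x| - 1) ^ 2 := by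
    rw [← sq_abs x]; field_simp; ring
  have h2 : 0 ≤ c⁻¹ * w⁻¹ * (c * w * |x| - 1) ^ 2 := by positivity
  linarith

lemma summable_of_mem_sobolevClass {β L : ℝ} (hβ : 1 / 2 < β) {θ : ℕ → ℝ}
    (hθ : θ ∈ sobolevClass β L) : Summable θ := by
  refine Summable.of_norm_bounded
    ((hθ.1.add (summable_rpow_neg (by linarith : 1 < 2 * β))).div_const 2) fun j => ?_
  have h := abs_le_weighted (c := 1) (x := θ j) (w := ((j : ℝ) + 1) ^ (2 * β)) one_pos
    (by positivity)
  rw [← Real.rpow_neg (by positivity)] at h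
  simpa using h

lemma sq_le_of_mem_sobolevClass {β L : ℝ} (hβ : 0 ≤ β) {θ : ℕ → ℝ} (hθ : θ ∈ sobolevClass β L)
    (j : ℕ) : θ j ^ 2 ≤ L := by
  have h1 := hθ.1.le_tsum j fun i _ => by positivity
  have h2 : (1 : ℝ) ≤ ((j : ℝ) + 1) ^ (2 * β) :=
    Real.one_le_rpow (by linarith [Nat.cast_nonneg (α := ℝ) j]) (by linarith)
  have h3 : θ j ^ 2 * 1 ≤ θ j ^ 2 * ((j : ℝ) + 1) ^ (2 * β) := by gcongr
  linarith [hθ.2]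

lemma sq_tsum_tail_le {β L : ℝ} (hβ : 1 / 2 < β) {θ : ℕ → ℝ}
    (hθ : θ ∈ sobolevClass β L) {K : ℕ} (hK : 1 ≤ K) :
    (∑' j, θ (j + K)) ^ 2 ≤ ((L + (2 * β - 1)⁻¹) / 2) ^ 2 * (K : ℝ) ^ (1 - 2 * β) := by
  have hK' : (0 : ℝ) < K := by exact_mod_cast hK
  -- This weight gives both halves of the AM-GM bound `abs_le_weighted` the same order `K ^ (1/2 -
  -- β)`.
  set c : ℝ := (K : ℝ) ^ (1 / 2 - β) with hc
  have hc0 : 0 < c := by positivity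
  have hcc : c ^ 2 = (K : ℝ) ^ (1 - 2 * β) := by
    rw [hc, ← Real.rpow_natCast, ← Real.rpow_mul hK'.le]; congr 1; push_cast; ring
  have hs1 : Summable fun j : ℕ => θ (j + K) ^ 2 * (((j + K : ℕ) : ℝ) + 1) ^ (2 * β) :=
    (summable_nat_add_iff K).2 hθ.1
  have hs2 : Summable fun j : ℕ => (((j + K : ℕ) : ℝ) + 1) ^ (-(2 * β)) :=
    (summable_nat_add_iff K).2 (summable_rpow_neg (by linarith))
  have hsθ : Summable fun j => |θ (j + K)| :=
    (summable_nat_add_iff K).2 (summable_of_mem_sobolevClass hβ hθ).abs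
  have hle : ∑' j : ℕ, θ (j + K) ^ 2 * (((j + K : ℕ) : ℝ) + 1) ^ (2 * β) ≤ L := by
    have h := hθ.1.sum_add_tsum_nat_add K
    have h0 : 0 ≤ ∑ i ∈ Finset.range K, θ i ^ 2 * ((i : ℝ) + 1) ^ (2 * β) :=
      Finset.sum_nonneg fun i _ => by positivity
    linarith [hθ.2]
  have htail := tsum_rpow_neg_le (by linarith : 1 < 2 * β) hK
  have habs : |∑' j, θ (j + K)| ≤ (L + (2 * β - 1)⁻¹) / 2 * c := by
    have h1 : |∑' j, θ (j + K)| ≤ ∑' j, |θ (j + K)| := by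
      simpa using norm_tsum_le_tsum_norm (f := fun j => θ (j + K)) (by simpa using hsθ)
    have h2 : ∑' j, |θ (j + K)| ≤
        ∑' j : ℕ, (c * (θ (j + K) ^ 2 * (((j + K : ℕ) : ℝ) + 1) ^ (2 * β)) +
          c⁻¹ * (((j + K : ℕ) : ℝ) + 1) ^ (-(2 * β))) / 2 := by
      refine hsθ.tsum_le_tsum (fun j => ?_) (((hs1.mul_left c).add (hs2.mul_left _)).div_const 2)
      rw [Real.rpow_neg (by positivity)]
      exact abs_le_weighted hc0 (by positivity)
    rw [tsum_div_const, (hs1.mul_left c).tsum_add (hs2.mul_left _), tsum_mul_left,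
      tsum_mul_left] at h2
    have h3 : c⁻¹ * ∑' j : ℕ, (((j + K : ℕ) : ℝ) + 1) ^ (-(2 * β)) ≤ (2 * β - 1)⁻¹ * c := by
      calc _ ≤ c⁻¹ * ((2 * β - 1)⁻¹ * (K : ℝ) ^ (1 - 2 * β)) := by gcongr
        _ = _ := by rw [← hcc]; field_simp
    have h4 := mul_le_mul_of_nonneg_left hle hc0.le
    linarith
  rw [← hcc, ← mul_pow, ← sq_abs]
  gcongr

lemma lintegral_sq_sum_sub (n : ℕ) (θ : ℕ → ℝ) (K : ℕ) :
    ∫⁻ X, ENNReal.ofReal ((∑ j ∈ Finset.range K, X j - ∑ j ∈ Finset.range K, θ j) ^ 2)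
      ∂(whiteNoiseLaw n θ) = ENNReal.ofReal (K * (n : ℝ)⁻¹) := by
  have hmp : ∀ j, MeasurePreserving (Function.eval j) (whiteNoiseLaw n θ)
      (gaussianReal (θ j) ((n : ℝ≥0)⁻¹)) := fun j =>
    measurePreserving_eval_infinitePi (fun j => gaussianReal (θ j) ((n : ℝ≥0)⁻¹)) j
  have hL : ∀ j, MemLp (fun X : ℕ → ℝ => X j) 2 (whiteNoiseLaw n θ) := fun j =>
    (memLp_id_gaussianReal' 2 (by simp)).comp_measurePreserving (hmp j)
  have hE : ∀ j, ∫ X, X j ∂(whiteNoiseLaw n θ) = θ j := fun j => by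
    have h := integral_map (μ := whiteNoiseLaw n θ) (φ := Function.eval j)
      (hmp j).measurable.aemeasurable (f := fun x : ℝ => x) (by fun_prop)
    rw [(hmp j).map_eq, integral_id_gaussianReal] at h
    exact h.symm
  have hV : ∀ j, Var[fun X : ℕ → ℝ => X j; whiteNoiseLaw n θ] = (n : ℝ)⁻¹ := fun j => by
    have h := variance_map (μ := whiteNoiseLaw n θ) (Y := Function.eval j) (X := fun x : ℝ => x)
      (by fun_prop) (hmp j).measurable.aemeasurable
    rw [(hmp j).map_eq, variance_fun_id_gaussianReal] at h
    exact h.symm.trans (by simp)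
  have hind : iIndepFun (fun j (X : ℕ → ℝ) => X j) (whiteNoiseLaw n θ) :=
    iIndepFun_infinitePi (P := fun j => gaussianReal (θ j) ((n : ℝ≥0)⁻¹)) (X := fun _ x => x)
      fun _ => measurable_id
  have hLs : MemLp (fun X : ℕ → ℝ => ∑ j ∈ Finset.range K, X j) 2 (whiteNoiseLaw n θ) :=
    memLp_finsetSum _ fun j _ => hL j
  have hvar := IndepFun.variance_sum (X := fun j (X : ℕ → ℝ) => X j) (s := Finset.range K)
    (μ := whiteNoiseLaw n θ) (fun j _ => hL j) (fun i _ j _ hij => hind.indepFun hij)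
  have hfun : (∑ j ∈ Finset.range K, fun X : ℕ → ℝ => X j) =
      fun X : ℕ → ℝ => ∑ j ∈ Finset.range K, X j := by ext X; simp
  rw [hfun, variance_eq_integral hLs.aestronglyMeasurable.aemeasurable,
    integral_finsetSum _ fun j _ => (hL j).integrable (by norm_num)] at hvar
  simp only [hE, hV, Finset.sum_const, Finset.card_range, nsmul_eq_mul] at hvar
  rw [← hvar, ofReal_integral_eq_lintegral_ofReal]
  · exact (hLs.sub (memLp_const _)).integrable_sq
  · exact ae_of_all _ fun X => sq_nonneg _

lemma lintegral_truncation_le {β L : ℝ} (hβ : 1 / 2 < β) {θ : ℕ → ℝ} (hθ : θ ∈ sobolevClass β L)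
    (n : ℕ) {K : ℕ} (hK : 1 ≤ K) :
    ∫⁻ X, ENNReal.ofReal ((∑ j ∈ Finset.range K, X j - ∑' j, 1 * θ j) ^ 2)
      ∂(whiteNoiseLaw n θ) ≤ ENNReal.ofReal (2 * (K * (n : ℝ)⁻¹) +
        2 * (((L + (2 * β - 1)⁻¹) / 2) ^ 2 * (K : ℝ) ^ (1 - 2 * β))) := by
  have hsum := (summable_of_mem_sobolevClass hβ hθ).sum_add_tsum_nat_add K
  have htail := sq_tsum_tail_le hβ hθ hK
  simp only [one_mul]
  have hm : Measurable fun X : ℕ → ℝ => ENNReal.ofReal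
      ((∑ j ∈ Finset.range K, X j - ∑ j ∈ Finset.range K, θ j) ^ 2) := by fun_prop
  calc _ ≤ ∫⁻ X, (ENNReal.ofReal 2 * ENNReal.ofReal
        ((∑ j ∈ Finset.range K, X j - ∑ j ∈ Finset.range K, θ j) ^ 2) +
        ENNReal.ofReal (2 * (((L + (2 * β - 1)⁻¹) / 2) ^ 2 * (K : ℝ) ^ (1 - 2 * β))))
          ∂(whiteNoiseLaw n θ) := by
        refine lintegral_mono fun X => ?_
        rw [← ENNReal.ofReal_mul (by norm_num), ← ENNReal.ofReal_add (by positivity) (by positivity)]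
        refine ENNReal.ofReal_le_ofReal ?_
        rw [← hsum]
        nlinarith [sq_nonneg ((∑ j ∈ Finset.range K, X j - ∑ j ∈ Finset.range K, θ j) +
          ∑' j, θ (j + K))]
    _ = _ := by
        rw [lintegral_add_right _ measurable_const, lintegral_const_mul _ hm,
          lintegral_sq_sum_sub, lintegral_const, measure_univ, mul_one,
          ← ENNReal.ofReal_mul (by norm_num), ← ENNReal.ofReal_add (by positivity) (by positivity)]

lemma minimaxPointwiseRisk_le {β L : ℝ} (hβ : 1 / 2 < β) :
    ∃ C : ℝ, 0 < C ∧ ∀ n : ℕ, 1 ≤ n →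
      minimaxPointwiseRisk n (fun _ => 1) (sobolevClass β L) ≤
        ENNReal.ofReal (C * (n : ℝ) ^ (-((2 * β - 1) / (2 * β)))) := by
  refine ⟨4 + 2 * ((L + (2 * β - 1)⁻¹) / 2) ^ 2, by positivity, fun n hn => ?_⟩
  have hn' : (1 : ℝ) ≤ n := by exact_mod_cast hn
  have hn0 : (0 : ℝ) < n := by linarith
  have hβ0 : 0 < 2 * β := by linarith
  set y : ℝ := (n : ℝ) ^ (1 / (2 * β)) with hy
  have hy1 : 1 ≤ y := Real.one_le_rpow hn' (by positivity)
  -- At this cutoff the variance `K / n` and the squared bias `K ^ (1 - 2β)` have the same order.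
  set K := ⌈y⌉₊ with hKdef
  have hyK : y ≤ K := Nat.le_ceil y
  have hKy : (K : ℝ) ≤ 2 * y := by
    have := Nat.ceil_lt_add_one (zero_le_one.trans hy1)
    linarith
  have hK : 1 ≤ K := by exact_mod_cast hy1.trans hyK
  have e1 : y * (n : ℝ)⁻¹ = (n : ℝ) ^ (-((2 * β - 1) / (2 * β))) := by
    rw [hy, ← Real.rpow_neg_one, ← Real.rpow_add hn0]; congr 1; field_simp; ring
  have e2 : y ^ (1 - 2 * β) = (n : ℝ) ^ (-((2 * β - 1) / (2 * β))) := by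
    rw [hy, ← Real.rpow_mul hn0.le]; congr 1; field_simp; ring
  refine iInf₂_le_of_le (fun X => ∑ j ∈ Finset.range K, X j) (by fun_prop)
    (iSup₂_le fun θ hθ => (lintegral_truncation_le hβ hθ n hK).trans
      (ENNReal.ofReal_le_ofReal ?_))
  have h1 : (K : ℝ) * (n : ℝ)⁻¹ ≤ 2 * (n : ℝ) ^ (-((2 * β - 1) / (2 * β))) := by
    rw [← e1, ← mul_assoc]; gcongr
  have h2 : (K : ℝ) ^ (1 - 2 * β) ≤ (n : ℝ) ^ (-((2 * β - 1) / (2 * β))) := by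
    rw [← e2]; exact Real.rpow_le_rpow_of_nonpos (by linarith) hyK (by linarith)
  have h3 : ((L + (2 * β - 1)⁻¹) / 2) ^ 2 * (K : ℝ) ^ (1 - 2 * β) ≤
      ((L + (2 * β - 1)⁻¹) / 2) ^ 2 * (n : ℝ) ^ (-((2 * β - 1) / (2 * β))) := by gcongr
  linarith

/-! ### The Poisson prior on the dimension. -/

/-- One term of the exponential series, `(r A²) ^ k / k! ≤ exp (r A²)`, is the whole estimate. The
constant `c` absorbs the conditioning on `k ≥ 1`. -/
lemma hasLightTail_of_le_poissonMeasure {r : ℝ≥0} {π : Measure ℕ} {c : ℝ≥0∞} (hc : c ≠ ∞)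
    (h : ∀ k, π {k} ≤ c * poissonMeasure r {k}) : HasLightTail π := by
  intro A hA
  have hD : 0 < (c.toReal + 1) * Real.exp (r * A ^ 2) := by positivity
  refine ⟨√((c.toReal + 1) * Real.exp (r * A ^ 2)), Real.sqrt_pos.2 hD, fun k => ?_⟩
  refine (h k).trans ?_
  rw [poissonMeasure_singleton, ← ENNReal.ofReal_pow (by positivity), mul_pow,
    Real.sq_sqrt hD.le, ← ENNReal.ofReal_toReal hc, ← ENNReal.ofReal_mul (by positivity),
    ENNReal.toReal_ofReal (by positivity)]
  refine ENNReal.ofReal_le_ofReal ?_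
  have h1 : Real.exp (-r) * (r : ℝ) ^ k / k.factorial ≤ Real.exp (r * A ^ 2) * (A⁻¹ ^ k) ^ 2 := by
    have h2 := Real.pow_div_factorial_le_exp (r * A ^ 2) (by positivity) k
    have h3 : Real.exp (-(r : ℝ)) ≤ 1 := Real.exp_le_one_iff.2 (by simp)
    calc Real.exp (-r) * (r : ℝ) ^ k / k.factorial ≤ 1 * (r : ℝ) ^ k / k.factorial := by gcongr
      _ = (r * A ^ 2) ^ k / k.factorial * (A⁻¹ ^ k) ^ 2 := by
          rw [mul_pow, inv_pow]; field_simp; ring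
      _ ≤ _ := by gcongr
  calc _ ≤ c.toReal * (Real.exp (r * A ^ 2) * (A⁻¹ ^ k) ^ 2) := by gcongr
    _ ≤ (c.toReal + 1) * (Real.exp (r * A ^ 2) * (A⁻¹ ^ k) ^ 2) := by gcongr; linarith
    _ = _ := by ring

lemma poissonMeasure_singleton_ne_zero {r : ℝ≥0} (hr : 0 < r) (k : ℕ) :
    poissonMeasure r {k} ≠ 0 := by
  rw [poissonMeasure_singleton]
  have : 0 < Real.exp (-r) * (r : ℝ) ^ k / k.factorial := by positivity
  simpa using this

lemma poisson_prior {r : ℝ≥0} (hr : 0 < r) {π : Measure ℕ}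
    (hπ : π = poissonMeasure r ∨ π = ProbabilityTheory.cond (poissonMeasure r) (Set.Ici 1)) :
    π {1} ≠ 0 ∧ HasLightTail π := by
  rcases hπ with rfl | rfl
  · exact ⟨poissonMeasure_singleton_ne_zero hr 1,
      hasLightTail_of_le_poissonMeasure (r := r) (c := 1) (by simp) fun k => by simp⟩
  · have h0 : poissonMeasure r (Set.Ici 1) ≠ 0 := fun h =>
      poissonMeasure_singleton_ne_zero hr 1 (measure_mono_null (by simp) h)
    have h1 : Set.Ici 1 ∩ {1} = ({1} : Set ℕ) := by ext; simp
    constructor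
    · rw [cond_apply measurableSet_Ici, h1]
      exact mul_ne_zero (ENNReal.inv_ne_zero.2 (measure_ne_top _ _))
        (poissonMeasure_singleton_ne_zero hr 1)
    · refine hasLightTail_of_le_poissonMeasure (r := r) (ENNReal.inv_ne_top.2 h0) fun k => ?_
      rw [cond_apply measurableSet_Ici]
      exact mul_le_mul_right (measure_mono Set.inter_subset_right) _

lemma priorVar_ne_zero {τ₀ q : ℝ} (hτ₀ : 0 < τ₀) (j : ℕ) : priorVar τ₀ q j ≠ 0 := by
  have : 0 < τ₀ * ((j : ℝ) + 1) ^ (-(2 * q)) := by positivity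
  simpa [priorVar] using this

/-! ### The least favourable parameter. -/

/-- The parameter with `m` equal coordinates `a`, followed by zeros. -/
def blockParam (m : ℕ) (a : ℝ) (j : ℕ) : ℝ := if j < m then a else 0

lemma hasSum_blockParam (m : ℕ) (a : ℝ) : HasSum (blockParam m a) (m * a) := by
  have h0 : ∀ j ∉ Finset.range m, blockParam m a j = 0 := fun j hj => if_neg (by simpa using hj)
  have h : HasSum (blockParam m a) _ := hasSum_sum_of_ne_finset_zero h0
  have e : ∑ j ∈ Finset.range m, blockParam m a j = m * a := by
    have h1 : ∀ j ∈ Finset.range m, blockParam m a j = a := fun j hj =>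
      if_pos (Finset.mem_range.1 hj)
    rw [Finset.sum_congr rfl h1]; simp
  rwa [e] at h

lemma blockParam_mem_sobolevClass {β L : ℝ} (hβ : 0 ≤ β) {m : ℕ} {a : ℝ}
    (h : a ^ 2 * (m * (m : ℝ) ^ (2 * β)) < L) : blockParam m a ∈ sobolevClass β L := by
  have h0 : ∀ j ∉ Finset.range m, blockParam m a j ^ 2 * ((j : ℝ) + 1) ^ (2 * β) = 0 :=
    fun j hj => by simp [blockParam, Finset.mem_range.not.1 hj]
  refine ⟨summable_of_ne_finset_zero h0, ?_⟩
  rw [tsum_eq_sum h0]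
  calc _ ≤ ∑ _j ∈ Finset.range m, a ^ 2 * (m : ℝ) ^ (2 * β) := by
        refine Finset.sum_le_sum fun j hj => ?_
        have hj' := Finset.mem_range.1 hj
        rw [blockParam, if_pos hj']
        have : (j : ℝ) + 1 ≤ m := by exact_mod_cast hj'
        gcongr
    _ = a ^ 2 * (m * (m : ℝ) ^ (2 * β)) := by simp; ring
    _ < L := h

/-- With `y = n ^ γ` this is a power of `y` against an exponential; the two floors cost at most `b +
1` in the exponent. -/
lemma tendsto_mul_two_inv_pow_floor {γ b : ℝ} (hγ : 0 < γ) (hb : 0 < b) :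
    Tendsto (fun n : ℕ => (n : ℝ) * 2⁻¹ ^ ⌊b * (⌊(n : ℝ) ^ γ⌋₊ : ℝ)⌋₊) atTop (nhds 0) := by
  have hl : 0 < Real.log 2 := Real.log_pos (by norm_num)
  have h1 := tendsto_rpow_mul_exp_neg_mul_atTop_nhds_zero γ⁻¹ (b * Real.log 2) (by positivity)
  have h2 := (h1.comp ((tendsto_rpow_atTop hγ).comp tendsto_natCast_atTop_atTop)).const_mul
    (Real.exp ((b + 1) * Real.log 2))
  rw [mul_zero] at h2
  refine squeeze_zero (fun n => by positivity) (fun n => ?_) h2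
  simp only [Function.comp_apply]
  rw [← Real.rpow_mul (Nat.cast_nonneg n), mul_inv_cancel₀ hγ.ne', Real.rpow_one, mul_left_comm,
    ← Real.exp_add]
  refine mul_le_mul_of_nonneg_left ?_ (Nat.cast_nonneg n)
  have e : (2⁻¹ : ℝ) = Real.exp (-Real.log 2) := by
    rw [Real.exp_neg, Real.exp_log (by norm_num)]
  rw [e, ← Real.exp_nat_mul]
  refine Real.exp_le_exp.2 ?_
  have f1 := Nat.lt_floor_add_one ((n : ℝ) ^ γ)
  have f2 := Nat.lt_floor_add_one (b * (⌊(n : ℝ) ^ γ⌋₊ : ℝ))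
  have f3 := mul_le_mul_of_nonneg_left f1.le hb.le
  have f4 : b * (n : ℝ) ^ γ - b - 1 ≤ (⌊b * (⌊(n : ℝ) ^ γ⌋₊ : ℝ)⌋₊ : ℝ) := by linarith
  nlinarith [mul_le_mul_of_nonneg_right f4 hl.le]

lemma exists_inv_evidence_bound {p : ℝ≥0∞} (hp0 : p ≠ 0) (hp : p ≠ ∞) (v : ℝ≥0) :
    ∃ κ : ℝ, 0 < κ ∧ ∀ n : ℕ, 1 ≤ n →
      (p * ENNReal.ofReal ((1 + n * v : ℝ)⁻¹))⁻¹ ≤ ENNReal.ofReal (κ * n) ^ 2 := by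
  have hp' : 0 < p.toReal := ENNReal.toReal_pos hp0 hp
  refine ⟨1 + (1 + v) / p.toReal, by positivity, fun n hn => ?_⟩
  have hn' : (1 : ℝ) ≤ n := by exact_mod_cast hn
  rw [← ENNReal.ofReal_toReal hp, ← ENNReal.ofReal_mul (by positivity),
    ENNReal.toReal_ofReal hp'.le,
    ← ENNReal.ofReal_inv_of_pos (by positivity), ← ENNReal.ofReal_pow (by positivity)]
  refine ENNReal.ofReal_le_ofReal ?_
  have h1 : (p.toReal * (1 + n * v : ℝ)⁻¹)⁻¹ = (1 + n * v) / p.toReal := by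
    rw [mul_inv, inv_inv, div_eq_inv_mul]
  have h2 : (1 + n * v : ℝ) / p.toReal ≤ (1 + v) / p.toReal * n := by
    rw [div_mul_eq_mul_div]
    gcongr
    nlinarith [v.coe_nonneg]
  rw [h1]
  have hx : 0 ≤ (1 + v) / p.toReal := by positivity
  -- The added `1` makes the base at least `1`, so that it is below its square. The resulting growth
  -- in `n` is crude but harmless against `2⁻¹ ^ J`.
  have h3 : 1 ≤ (1 + (1 + v) / p.toReal) * n := by nlinarith
  calc _ ≤ (1 + v) / p.toReal * n := h2
    _ ≤ (1 + (1 + v) / p.toReal) * n := by gcongr; linarith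
    _ ≤ _ := le_self_pow₀ h3 (by norm_num)

lemma iSup_pointwiseRisk_ge {π : Measure ℕ} (hπ1 : π {1} ≠ 0) (hπ : HasLightTail π)
    {v : ℕ → ℝ≥0} (hv : ∀ i, v i ≠ 0) {β L : ℝ} (hβ : 1 / 2 < β) (hL : 0 < L) :
    ∃ c : ℝ, 0 < c ∧ ∀ᶠ n : ℕ in atTop,
      ENNReal.ofReal (c * (n : ℝ) ^ (-((2 * β - 1) / (2 * β + 1)))) ≤
        ⨆ θ ∈ sobolevClass β L,
          pointwiseRisk n (fun _ => 1) (posteriorMean n (sievePrior π v)) θ := by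
  -- The half gives the strict inequality in the class. As `n θ_j² ≤ η²` throughout, `M` and `D` do
  -- not depend on `n`.
  set η : ℝ := √(L / 2) with hη
  have hη0 : 0 < η := Real.sqrt_pos.2 (by linarith)
  have hη2 : η ^ 2 = L / 2 := Real.sq_sqrt (by linarith)
  set M : ℝ := 3 * Real.exp (3 * η ^ 2) with hM
  have hM0 : 0 < M := by positivity
  obtain ⟨D, hD, hπD⟩ := hπ (8 * M) (by positivity)
  have hπtop : π {1} ≠ ∞ :=
    ne_top_of_le_ne_top (ENNReal.pow_ne_top ENNReal.ofReal_ne_top) (hπD 1)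
  obtain ⟨κ, hκ0, hκ⟩ := exists_inv_evidence_bound hπ1 hπtop (v 0)
  set γ : ℝ := 1 / (2 * β + 1) with hγ
  have hγ0 : 0 < γ := by positivity
  -- Chosen so that the first `J` coordinates use half of the budget `f / 4`; the tail gets the
  -- other half through the threshold `η / (48 * D * κ)`.
  set b : ℝ := η / (24 * M) with hb
  have hb0 : 0 < b := by positivity
  have hlim := (tendsto_mul_two_inv_pow_floor hγ0 hb0).eventually_lt_const
    (show 0 < η / (48 * D * κ) by positivity)
  refine ⟨η ^ 2 / 8, by positivity, ?_⟩
  filter_upwards [hlim, eventually_ge_atTop 1] with n hsmall hn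
  have hn' : (1 : ℝ) ≤ n := by exact_mod_cast hn
  have hn0 : (0 : ℝ) < n := by linarith
  have hs : 0 < √(n : ℝ) := Real.sqrt_pos.2 hn0
  have hss : √(n : ℝ) ^ 2 = n := Real.sq_sqrt hn0.le
  have hy1 : 1 ≤ (n : ℝ) ^ γ := Real.one_le_rpow hn' hγ0.le
  set m := ⌊(n : ℝ) ^ γ⌋₊ with hm
  have hm1 : 1 ≤ m := Nat.le_floor (by simpa using hy1)
  have hm1' : (1 : ℝ) ≤ m := by exact_mod_cast hm1
  have hmy : (m : ℝ) ≤ (n : ℝ) ^ γ := Nat.floor_le (by linarith)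
  have hym : (n : ℝ) ^ γ / 2 ≤ m := by
    have := Nat.lt_floor_add_one ((n : ℝ) ^ γ)
    linarith
  set a : ℝ := η / √n with ha
  have ha2 : a ^ 2 = η ^ 2 / n := by rw [ha, div_pow, hss]
  have hmem : blockParam m a ∈ sobolevClass β L := by
    refine blockParam_mem_sobolevClass (by linarith) ?_
    have h1 : (m : ℝ) * (m : ℝ) ^ (2 * β) ≤ n := by
      have e : (m : ℝ) * (m : ℝ) ^ (2 * β) = (m : ℝ) ^ (2 * β + 1) := by
        rw [Real.rpow_add (by linarith), Real.rpow_one, mul_comm]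
      have e2 : ((n : ℝ) ^ γ) ^ (2 * β + 1) = n := by
        rw [← Real.rpow_mul hn0.le, hγ, one_div, inv_mul_cancel₀ (by linarith), Real.rpow_one]
      rw [e, ← e2]
      exact Real.rpow_le_rpow (by linarith) hmy (by linarith)
    calc a ^ 2 * (m * (m : ℝ) ^ (2 * β)) ≤ a ^ 2 * n := by gcongr
      _ = η ^ 2 := by rw [ha2]; field_simp
      _ < L := by rw [hη2]; linarith
  have hA : ∀ j, n * blockParam m a j ^ 2 ≤ η ^ 2 := by
    intro j
    unfold blockParam
    split_ifs
    · rw [ha2]; exact (mul_div_cancel₀ _ hn0.ne').le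
    · simpa using sq_nonneg η
  have hsum := hasSum_blockParam m a
  have hf0 : 0 < m * a := by positivity
  set J := ⌊b * (m : ℝ)⌋₊ with hJ
  have hJb : (J : ℝ) ≤ b * m := Nat.floor_le (by positivity)
  have hrisk := pointwiseRisk_posteriorMean_ge hD hM hπD hn hv (by positivity) (hκ n hn) hA
    hsum.summable hsum.tsum_eq hf0 J (by
      have h1 : (J : ℝ) * M ≤ η * m / 24 := by
        calc (J : ℝ) * M ≤ b * m * M := by gcongr
          _ = _ := by rw [hb]; field_simp
      have h2 : κ * n * (2 * D * 2⁻¹ ^ J) ≤ η * m / 24 := by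
        calc κ * n * (2 * D * 2⁻¹ ^ J) = 2 * D * κ * (n * 2⁻¹ ^ J) := by ring
          _ ≤ 2 * D * κ * (η / (48 * D * κ)) := by gcongr
          _ = η / 24 := by field_simp; norm_num
          _ ≤ η * m / 24 := by nlinarith
      calc 3 * (√(n : ℝ))⁻¹ * (J * M + κ * n * (2 * D * 2⁻¹ ^ J))
          ≤ 3 * (√(n : ℝ))⁻¹ * (η * m / 24 + η * m / 24) := by gcongr
        _ = m * a / 4 := by rw [ha]; field_simp; norm_num)
  refine le_trans (ENNReal.ofReal_le_ofReal ?_) (hrisk.trans (le_iSup₂_of_le _ hmem le_rfl))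
  have e : (n : ℝ) ^ (-((2 * β - 1) / (2 * β + 1))) = ((n : ℝ) ^ γ) ^ 2 / n := by
    rw [← Real.rpow_natCast, ← Real.rpow_mul hn0.le, ← Real.rpow_sub_one hn0.ne']
    congr 1
    rw [hγ]; push_cast; field_simp; ring
  calc _ = η ^ 2 / n * ((n : ℝ) ^ γ / 2) ^ 2 / 2 := by rw [e]; ring
    _ ≤ η ^ 2 / n * (m : ℝ) ^ 2 / 2 := by gcongr
    _ = _ := by rw [mul_pow, ha2]; ring

end

end SieveWhiteNoise

theorem mainTheorem6
    (r : ℝ≥0) (hr : 0 < r)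
    (π : Measure ℕ)
    (hπ : π = poissonMeasure r ∨ π = ProbabilityTheory.cond (poissonMeasure r) (Set.Ici 1))
    (τ₀ : ℝ) (hτ₀ : 0 < τ₀) (q : ℝ) (hq : 1 / 2 < q)
    (ψ : ℕ → ℝ → ℝ) (hψ : IsOrthonormalBasisL2 ψ)
    (t : ℝ) (ht : t ∈ Set.Icc (0 : ℝ) 1) (hψt : ∀ j, ψ j t = 1)
    (β : ℝ) (hβ : q ≤ β) (L₀ : ℝ) (hL₀ : 0 < L₀) :
    (∀ n : ℕ, 1 ≤ n → ∀ θ₀ ∈ sobolevClass β L₀, ∀ᵐ X ∂(whiteNoiseLaw n θ₀),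
      IsProbabilityMeasure (posteriorDist n (sievePrior π (priorVar τ₀ q)) X) ∧
      (∀ j, Integrable (fun θ : ℕ → ℝ => θ j)
        (posteriorDist n (sievePrior π (priorVar τ₀ q)) X)) ∧
      Summable (fun j => ψ j t *
        (posteriorMean n (sievePrior π (priorVar τ₀ q)) X j - θ₀ j))) ∧
    (∃ c : ℝ, 0 < c ∧ ∀ᶠ n : ℕ in atTop,
      ENNReal.ofReal (c * ((n : ℝ) ^ (-((2 * β - 1) / (2 * β + 1))) / Real.log n ^ 2)) ≤
        ⨆ θ₀ ∈ sobolevClass β L₀,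
          pointwiseRisk n (fun j => ψ j t)
            (posteriorMean n (sievePrior π (priorVar τ₀ q))) θ₀) ∧
    (∃ C : ℝ, 0 < C ∧ ∀ᶠ n : ℕ in atTop,
      minimaxPointwiseRisk n (fun j => ψ j t) (sobolevClass β L₀) ≤
        ENNReal.ofReal (C * (n : ℝ) ^ (-((2 * β - 1) / (2 * β))))) := by
  obtain ⟨hπ1, hπt⟩ := poisson_prior hr hπ
  have hv : ∀ j, priorVar τ₀ q j ≠ 0 := priorVar_ne_zero hτ₀
  have hβ' : 1 / 2 < β := hq.trans_le hβ
  simp only [hψt]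
  refine ⟨fun n hn θ₀ hθ₀ => ?_, ?_, ?_⟩
  · have hA : ∀ j, n * θ₀ j ^ 2 ≤ n * L₀ := fun j =>
      mul_le_mul_of_nonneg_left (sq_le_of_mem_sobolevClass (by linarith) hθ₀ j) (Nat.cast_nonneg n)
    filter_upwards [ae_posterior_regular hπ1 hπt hn hv hA] with X hX
    refine ⟨hX.1, fun j => ⟨(measurable_pi_apply j).aestronglyMeasurable, ?_⟩, ?_⟩
    · exact lt_top_iff_ne_top.2 (ENNReal.ne_top_of_tsum_ne_top hX.2 j)
    · simp only [one_mul]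
      exact (summable_of_tsum_enorm_ne_top (ne_top_of_le_ne_top hX.2
        (ENNReal.tsum_le_tsum fun j => enorm_posteriorMean_le n _ X j))).sub
          (summable_of_mem_sobolevClass hβ' hθ₀)
  · obtain ⟨c, hc, h⟩ := iSup_pointwiseRisk_ge hπ1 hπt hv hβ' hL₀
    refine ⟨c, hc, ?_⟩
    -- Once `log n ≥ 1`, dividing by `log² n` only weakens the bound already obtained.
    have hlog := (Real.tendsto_log_atTop.comp tendsto_natCast_atTop_atTop).eventually_ge_atTop 1
    filter_upwards [h, hlog] with n hn hl
    refine le_trans (ENNReal.ofReal_le_ofReal ?_) hn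
    gcongr
    exact div_le_self (by positivity) (one_le_pow₀ hl)
  · obtain ⟨C, hC, h⟩ := minimaxPointwiseRisk_le (L := L₀) hβ'
    refine ⟨C, hC, ?_⟩
    filter_upwards [eventually_ge_atTop 1] with n hn using h n hn
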